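/- Let $G=(V,E)$ be an infinite (simple) graph, and let $\mathcal X$ be the set of all finite subsets of $V$. For $X\in\mathcal X$ let $\mathcal C_X$ be the set of components of $G-X$. The set $X$ is *critical* if infinitely many $C\in\mathcal C_X$ have neighbourhood exactly $X$; let $\mathrm{crit}(G)$ be the set of critical vertex sets. An *end* of $G$ is an equivalence class of rays, two rays being equivalent if for every $X\in\mathcal X$ both have a tail in the same component of $G-X$; let $\Omega$ be the set of ends, and for $\omega\in\Omega$ let $C(X,\omega)$ be the component of $G-X$ in which every ray of $\omega$ has a tail. A (finite order) *oriented separation* is a pair $(A,B)$ with $A\cup B=V$, $A\cap B$ finite and no edge between $A\setminus B$ and $B\setminus A$; write $(A,B)\le(C,D)$ if $A\subseteq C$ and $B\supseteq D$. A *star* is a set $\sigma$ of oriented separations such that $(A,B)\le(C,D)$ for any two distinct $(A,B),(D,C)\in\sigma$; its *interior* is $\bigcap_{(A,B)\in\sigma}B$. An *$\aleph_0$-tangle* of $G$ is a set $\tau$ of oriented separations that contains exactly one of $(A,B),(B,A)$ for each separation, contains no two distinct elements $(B,A),(C,D)$ with $(A,B)<(C,D)$, and includes no finite star of finite interior. Let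 $\Theta$ be the set of $\aleph_0$-tangles. For $\mathcal C\subseteq\mathcal C_X$ let $V[\mathcal C]$ be the set of vertices of the components in $\mathcal C$. For $\tau\in\Theta$ and $X\in\mathcal X$ let $U(\tau,X)$ be the ultrafilter of all $\mathcal C\subseteq\mathcal C_X$ with $(V\setminus V[\mathcal C],\,X\cup V[\mathcal C])\in\tau$, and let $\mathcal X_\tau$ be the set of all $X\in\mathcal X$ for which $U(\tau,X)$ is free. Call $\tau$ an *ultrafilter tangle* if $\mathcal X_\tau\ne\emptyset$, and let $X_\tau$ be the least element of $\mathcal X_\tau$ under inclusion. For $\omega\in\Omega$ let $\tau_\omega$ be the set of oriented separations $(A,B)$ with $C(A\cap B,\omega)\subseteq G[B\setminus A]$. Write $G$ also for the 1-complex of $G$. Let $|G|_\Theta=G\sqcup\Theta$ carry the topology generated by the open sets of $G$ together with, for all $X\in\mathcal X$ and $\mathcal C\subseteq\mathcal C_X$, the sets consisting of $V[\mathcal C]$, the inner points of all edges with an endvertex in $V[\mathcal C]$, and all $\tau\in\Theta$ with $\mathcal C\in U(\tau,X)$. Let $\sim$ identify two ultrafilter tangles $\tau,\tau'$ if and only if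 $X_\tau=X_{\tau'}$ (and make no other identifications), and give $|G|_\Theta/{\sim}$ the quotient topology. **Theorem 4.11.** Every infinite graph $G$ is compactified by its ends plus its critical vertex sets, as witnessed by $|G|_\Theta/{\sim}$. That is: $X_\tau$ exists for every ultrafilter tangle $\tau$; the space $|G|_\Theta/{\sim}$ is compact, and the canonical map $G\to|G|_\Theta/{\sim}$ is a topological embedding with dense image; and there is a bijection from $\Omega\sqcup\mathrm{crit}(G)$ onto the remainder $(|G|_\Theta/{\sim})\setminus G$ that sends each end $\omega$ to the class $\{\tau_\omega\}$ and each critical set $X$ to the class $\{\tau\in\Theta : \tau \text{ is an ultrafilter tangle with } X_\tau=X\}$. -/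

import Mathlib

open Set Topology

universe u

namespace GraphEnds

variable {V : Type u} (G : SimpleGraph V)

section Ends

/-- A ray (one-way infinite path), given by its sequence of vertices from the initial vertex on. -/
structure Ray where
  toFun : ℕ → V
  injective : Function.Injective toFun
  adj : ∀ n, G.Adj (toFun n) (toFun (n + 1))

variable {G}

/-- The ray `r` has a tail in the component `C` of `G - X`. -/
def Ray.HasTailIn (r : Ray G) {X : Set V} (C : G.ComponentCompl X) : Prop :=
  ∃ N, ∀ n ≥ N, r.toFun n ∈ C

theorem Ray.exists_hasTailIn (r : Ray G) (X : Finset V) :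
    ∃ C : G.ComponentCompl (X : Set V), r.HasTailIn C := by
  have hfin : (r.toFun ⁻¹' (X : Set V)).Finite :=
    X.finite_toSet.preimage r.injective.injOn
  obtain ⟨M, hM⟩ := hfin.bddAbove
  have hout : ∀ n ≥ M + 1, r.toFun n ∉ (X : Set V) := by
    intro n hn hmem
    have : n ≤ M := hM hmem
    omega
  refine ⟨G.componentComplMk (hout (M + 1) le_rfl), M + 1, fun n hn => ?_⟩
  induction n, hn using Nat.le_induction with
  | base => exact ⟨hout _ le_rfl, rfl⟩
  | succ n hn ih =>
    exact SimpleGraph.ComponentCompl.mem_of_adj _ _ ih (hout (n + 1) (by omega)) (r.adj n)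

theorem Ray.HasTailIn.unique {r : Ray G} {X : Set V} {C D : G.ComponentCompl X}
    (hC : r.HasTailIn C) (hD : r.HasTailIn D) : C = D := by
  obtain ⟨N, hN⟩ := hC
  obtain ⟨M, hM⟩ := hD
  obtain ⟨h, rfl⟩ := hN (max N M) (le_max_left _ _)
  obtain ⟨h', rfl⟩ := hM (max N M) (le_max_right _ _)
  rfl

variable (G)

/-- Two rays are equivalent if, for every finite set `X` of vertices, both have a tail in the same
component of `G - X`. -/
def raySetoid : Setoid (Ray G) where
  r r s := ∀ X : Finset V, ∃ C : G.ComponentCompl (X : Set V), r.HasTailIn C ∧ s.HasTailIn C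
  iseqv :=
    { refl := fun r X => by
        obtain ⟨C, hC⟩ := r.exists_hasTailIn X
        exact ⟨C, hC, hC⟩
      symm := fun h X => by
        obtain ⟨C, hC, hC'⟩ := h X
        exact ⟨C, hC', hC⟩
      trans := fun h h' X => by
        obtain ⟨C, hr, hs⟩ := h X
        obtain ⟨D, hs', ht⟩ := h' X
        exact ⟨C, hr, hs.unique hs' ▸ ht⟩ }

/-- The set `Ω(G)` of ends: equivalence classes of rays. -/
def GEnd := Quotient (raySetoid G)

variable {G}

/-- `C = C(X, ω)`: every ray of the end `ω` has a tail in the component `C` of `G - X`. -/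
def GEnd.LivesIn (ω : GEnd G) {X : Set V} (C : G.ComponentCompl X) : Prop :=
  ∀ r : Ray G, (Quotient.mk (raySetoid G) r : GEnd G) = ω → r.HasTailIn C

end Ends

section Critical

/-- The neighbourhood of a set `C` of vertices. -/
def nbhd (C : Set V) : Set V := {v | v ∉ C ∧ ∃ u ∈ C, G.Adj u v}

/-- The finite set `X` is critical: infinitely many components of `G - X` have neighbourhood
exactly `X`. -/
def IsCritical (X : Finset V) : Prop :=
  {C : G.ComponentCompl (X : Set V) | nbhd G (C : Set V) = (X : Set V)}.Infinite

/-- The set `crit(G)` of critical vertex sets. -/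
def Crit := {X : Finset V // IsCritical G X}

end Critical

section Tangles

/-- `(A, B)` is an (oriented) finite order separation of `G`. -/
def IsSeparation (p : Set V × Set V) : Prop :=
  (p.1 ∩ p.2).Finite ∧ p.1 ∪ p.2 = univ ∧ ∀ a ∈ p.1 \ p.2, ∀ b ∈ p.2 \ p.1, ¬ G.Adj a b

/-- `(A, B) ≤ (C, D)` if `A ⊆ C` and `B ⊇ D`. -/
def SepLE (p q : Set V × Set V) : Prop := p.1 ⊆ q.1 ∧ q.2 ⊆ p.2

/-- `O` is an orientation of the collection of all finite order separations of `G`: it consists of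
oriented separations and contains exactly one of `(A, B)` and `(B, A)` for each separation. -/
def IsOrientation (O : Set (Set V × Set V)) : Prop :=
  (∀ p ∈ O, IsSeparation G p) ∧ ∀ p, IsSeparation G p → Xor (p ∈ O) (p.swap ∈ O)

/-- No two distinct separations `p = (B, A)` and `q = (C, D)` in `O` satisfy `(A, B) < (C, D)`,
that is, point away from each other. -/
def IsConsistent (O : Set (Set V × Set V)) : Prop :=
  ∀ p ∈ O, ∀ q ∈ O, p ≠ q → ¬ (SepLE p.swap q ∧ p.swap ≠ q)

/-- Any two distinct separations `(A, B)` and `(D, C)` in `σ` point towards each other, that is,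
`(A, B) ≤ (C, D)`. -/
def IsStar (σ : Set (Set V × Set V)) : Prop :=
  ∀ p ∈ σ, ∀ q ∈ σ, p ≠ q → SepLE p q.swap

/-- The interior of a star: the intersection of all its big sides. -/
def starInterior (σ : Set (Set V × Set V)) : Set V := ⋂ p ∈ σ, p.2

/-- The set of all finite stars of finite order separations of `G` that have finite interior. -/
def finiteStars : Set (Set (Set V × Set V)) :=
  {σ | (∀ p ∈ σ, IsSeparation G p) ∧ IsStar σ ∧ σ.Finite ∧ (starInterior σ).Finite}

/-- An `𝓕`-tangle of the collection of all finite order separations of `G`: a consistent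
orientation no subset of which belongs to `𝓕`. -/
def IsTangle (F : Set (Set (Set V × Set V))) (τ : Set (Set V × Set V)) : Prop :=
  IsOrientation G τ ∧ IsConsistent τ ∧ ∀ σ ⊆ τ, σ ∉ F

/-- The set `Θ` of all `ℵ₀`-tangles of `G`. -/
def Tangle := {τ : Set (Set V × Set V) // IsTangle G (finiteStars G) τ}

variable {G}

/-- `V[𝓒]`, the set of vertices in the components in `𝓒`. -/
def verts {X : Set V} (𝓒 : Set (G.ComponentCompl X)) : Set V := ⋃ C ∈ 𝓒, (C : Set V)

/-- The separation `(V \ V[𝓒], X ∪ V[𝓒])`, which points from `X` towards `𝓒`. -/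
def sepTo {X : Finset V} (𝓒 : Set (G.ComponentCompl (X : Set V))) : Set V × Set V :=
  ((verts 𝓒)ᶜ, (X : Set V) ∪ verts 𝓒)

/-- The ultrafilter `U(τ, X)` on the set of components of `G - X` induced by `τ`, as a family
of sets. -/
def Tangle.ultra (τ : Tangle G) (X : Finset V) : Set (Set (G.ComponentCompl (X : Set V))) :=
  {𝓒 | sepTo 𝓒 ∈ τ.1}

/-- The collection `𝓧_τ` of all finite `X` for which the ultrafilter `U(τ, X)` is free
(contains no singleton). -/
def Tangle.freeSets (τ : Tangle G) : Set (Finset V) :=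
  {X | ∀ C : G.ComponentCompl (X : Set V), {C} ∉ τ.ultra X}

/-- `τ` is an ultrafilter tangle: some `U(τ, X)` is free. -/
def Tangle.IsUltrafilterTangle (τ : Tangle G) : Prop := τ.freeSets.Nonempty

/-- `X = X_τ`, the least element of `𝓧_τ`. -/
def Tangle.IsX (τ : Tangle G) (X : Finset V) : Prop := IsLeast τ.freeSets X

/-- The end tangle `τ_ω`: all finite order separations `(A, B)` such that
`C(A ∩ B, ω) ⊆ G[B \ A]`. -/
def GEnd.tangleSet (ω : GEnd G) : Set (Set V × Set V) :=
  {p | IsSeparation G p ∧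
    ∃ C : G.ComponentCompl (p.1 ∩ p.2), ω.LivesIn C ∧ (C : Set V) ⊆ p.2 \ p.1}

end Tangles

section Spaces

/-- The points of the 1-complex of `G`: the vertices, and for each edge a copy of `(0, 1)`
consisting of its inner points. -/
inductive Complex where
  | vertex (v : V)
  | inner (e : G.edgeSet) (t : Ioo (0 : ℝ) 1)

open Classical in
/-- The topological edge `e = xy` as a copy of `[0, 1]`, parametrised from one endvertex (chosen
arbitrarily) to the other. -/
noncomputable def edgeMap (e : G.edgeSet) (t : Icc (0 : ℝ) 1) : Complex G :=
  if h : (t : ℝ) ∈ Ioo (0 : ℝ) 1 then .inner e ⟨t, h⟩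
  else if (t : ℝ) = 0 then .vertex (Quot.out e.1).1 else .vertex (Quot.out e.1).2

/-- The topology of the 1-complex: a set is open if and only if it meets every topological edge
in an open set. So the sets obtained from a vertex `v` by choosing on each edge at `v` an
arbitrary half-open initial segment `[v, i)` form a neighbourhood basis at `v`. -/
noncomputable instance : TopologicalSpace (Complex G) :=
  ⨆ e : G.edgeSet, TopologicalSpace.coinduced (edgeMap G e) inferInstance

/-- The point set of `|G|_Θ`, the disjoint union of the 1-complex of `G` and `Θ`. -/
inductive TangleComp where
  | point (x : Complex G)
  | tangle (τ : Tangle G)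

variable {G}

/-- The set `⋃𝓒 ∪ E̊(X, ⋃𝓒) ∪ {τ | 𝓒 ∈ U(τ, X)}`. Here `⋃𝓒` is a subgraph, and includes the inner
points of its edges; as the components in `𝓒` send edges only to `X`, the edges of `⋃𝓒` and those
between `X` and `⋃𝓒` together are all the edges with an endvertex in `V[𝓒]`. -/
def basicOpen {X : Finset V} (𝓒 : Set (G.ComponentCompl (X : Set V))) : Set (TangleComp G) :=
  {p | match p with
    | .point (.vertex v) => v ∈ verts 𝓒
    | .point (.inner e _) => ∃ v ∈ e.1, v ∈ verts 𝓒
    | .tangle τ => 𝓒 ∈ τ.ultra X}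

variable (G)

/-- The topology of the tangle compactification `|G|_Θ`. -/
noncomputable instance : TopologicalSpace (TangleComp G) :=
  TopologicalSpace.generateFrom
    ({W | ∃ U : Set (Complex G), IsOpen U ∧ W = TangleComp.point '' U} ∪
     {W | ∃ (X : Finset V) (𝓒 : Set (G.ComponentCompl (X : Set V))), W = basicOpen 𝓒})

/-- The equivalence relation on `|G|_Θ` whose only non-trivial identifications are those of
ultrafilter tangles `τ`, `τ'` with `X_τ = X_τ'`. -/
def tangleSetoid : Setoid (TangleComp G) where
  r p q := p = q ∨ ∃ τ τ' : Tangle G, p = .tangle τ ∧ q = .tangle τ' ∧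
    ∃ X : Finset V, τ.IsX X ∧ τ'.IsX X
  iseqv :=
    { refl := fun _ => Or.inl rfl
      symm := by
        rintro p q (rfl | ⟨τ, τ', hp, hq, X, h, h'⟩)
        · exact Or.inl rfl
        · exact Or.inr ⟨τ', τ, hq, hp, X, h', h⟩
      trans := by
        rintro p q s (rfl | ⟨τ, τ', rfl, rfl, X, h, h'⟩) hqs
        · exact hqs
        · rcases hqs with rfl | ⟨τ₁, τ₂, h₁, rfl, Y, k, k'⟩
          · exact Or.inr ⟨τ, τ', rfl, rfl, X, h, h'⟩
          · cases h₁
            obtain rfl := IsLeast.unique h' k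
            exact Or.inr ⟨τ, τ₂, rfl, rfl, X, h, k'⟩ }

/-- The quotient space `|G|_Θ/∼`, with the quotient topology. -/
abbrev CritComp := Quotient (tangleSetoid G)

variable {G}

/-- The canonical map from the 1-complex of `G` to `|G|_Θ/∼`. -/
def CritComp.ofPoint (x : Complex G) : CritComp G := Quotient.mk (tangleSetoid G) (.point x)

/-- The class `[τ]` of a tangle `τ` in `|G|_Θ/∼`. -/
def CritComp.ofTangle (τ : Tangle G) : CritComp G := Quotient.mk (tangleSetoid G) (.tangle τ)

/-- `(K, h)` is a compactification of the space `X`: `K` is compact and `h` embeds `X` as a dense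
subset of `K`. -/
def IsCompactification {X K : Type*} [TopologicalSpace X] [TopologicalSpace K] (h : X → K) :
    Prop :=
  CompactSpace K ∧ IsEmbedding h ∧ DenseRange h

end Spaces

end GraphEnds

namespace GraphEnds

open Filter SimpleGraph

variable {V : Type u} {G : SimpleGraph V}

/-! ### Separations and the calculus of tangles -/

section Separations

/-! A tangle selects for each separation a strict big side `p.2 \ p.1`. It is closed under suprema
`(A ∪ C, B ∩ D)` (`Tangle.sup_mem`), so the selected sides generate a filter of infinite vertex
sets; conversely every free ultrafilter on `V` induces a tangle (`isTangle_ultrafilterSeps`). In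
particular each U(τ, X) is an ultrafilter on the components of G - X.

Suppose U(τ, X) is free. The components of G - X have only finitely many possible neighbourhoods, so
one set Y ⊆ X is the neighbourhood of almost all of them. These are also components of G - Y, and
U(τ, Y) is free. Moreover Y lies in every X' with U(τ, X') free: given y ∈ Y \ X', almost all these
components avoid X' and are joined to y, so they lie in a single component of G - X'. Hence X_τ = Y,
and Y is critical. Conversely, a free ultrafilter on the components with neighbourhood X yields a
tangle τ with X_τ = X.

If no U(τ, X) is free, the components C with {C} ∈ U(τ, X) form a direction. Every direction is
induced by a ray (`exists_ray_of_direction`), and τ is the tangle of its end.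

For compactness, take an ultrafilter on |G|_Θ. If it contains a finite subgraph, it converges by
compactness there. Otherwise it orients every separation; a finite star of finite interior would
trap it in a finite subgraph, so the orientation is a tangle, to which it converges. Compactness and
density pass to the quotient, and G stays embedded because its points are not identified with
anything. -/

theorem IsSeparation.swap {p : Set V × Set V} (hp : IsSeparation G p) :
    IsSeparation G p.swap :=
  ⟨by simpa [inter_comm] using hp.1, by simpa [union_comm] using hp.2.1,
    fun a ha b hb h => hp.2.2 b hb a ha h.symm⟩

theorem IsSeparation.mem_or {p : Set V × Set V} (hp : IsSeparation G p) (v : V) :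
    v ∈ p.1 ∨ v ∈ p.2 := by
  have : v ∈ p.1 ∪ p.2 := hp.2.1 ▸ mem_univ v
  exact this

theorem IsSeparation.sup {p q : Set V × Set V} (hp : IsSeparation G p) (hq : IsSeparation G q) :
    IsSeparation G (p.1 ∪ q.1, p.2 ∩ q.2) := by
  refine ⟨(hp.1.union hq.1).subset ?_, ?_, ?_⟩
  · rintro v ⟨h | h, h₁, h₂⟩
    · exact Or.inl ⟨h, h₁⟩
    · exact Or.inr ⟨h, h₂⟩
  · refine eq_univ_of_forall fun v => ?_
    have := hp.mem_or v
    have := hq.mem_or v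
    simp only [mem_union, mem_inter_iff]
    tauto
  · rintro a ⟨-, ha⟩ b ⟨⟨hb₁, hb₂⟩, hb⟩ hab
    simp only [mem_union, mem_inter_iff, not_or, not_and_or] at ha hb
    rcases ha with ha | ha
    · exact hp.2.2 a ⟨(hp.mem_or a).resolve_right ha, ha⟩ b ⟨hb₁, hb.1⟩ hab
    · exact hq.2.2 a ⟨(hq.mem_or a).resolve_right ha, ha⟩ b ⟨hb₂, hb.2⟩ hab

end Separations

section TangleBasics

variable (τ : Tangle G)

theorem Tangle.isSeparation {p : Set V × Set V} (hp : p ∈ τ.1) : IsSeparation G p :=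
  τ.2.1.1 p hp

theorem Tangle.mem_or_swap_mem {p : Set V × Set V} (hp : IsSeparation G p) :
    p ∈ τ.1 ∨ p.swap ∈ τ.1 :=
  (τ.2.1.2 p hp).or

theorem Tangle.swap_notMem {p : Set V × Set V} (hp : p ∈ τ.1) : p.swap ∉ τ.1 := by
  rcases τ.2.1.2 p (τ.isSeparation hp) with h | h
  · exact h.2
  · exact absurd hp h.2

/-- The singleton `{p}` is already a star, with interior `p.2`. -/
theorem Tangle.infinite_snd {p : Set V × Set V} (hp : p ∈ τ.1) : p.2.Infinite := by
  intro hfin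
  refine τ.2.2.2 {p} (singleton_subset_iff.2 hp) ⟨?_, ?_, finite_singleton p, ?_⟩
  · rintro q rfl
    exact τ.isSeparation hp
  · rintro q rfl r rfl h
    exact absurd rfl h
  · simpa [starInterior] using hfin

theorem Tangle.mem_of_le {p q : Set V × Set V} (hq : q ∈ τ.1) (hp : IsSeparation G p)
    (hpq : SepLE p q) : p ∈ τ.1 := by
  by_contra hpn
  have hps := (τ.mem_or_swap_mem hp).resolve_left hpn
  refine τ.2.2.1 p.swap hps q hq ?_ ⟨hpq, ?_⟩
  -- If `p.swap = q`, then `p ≤ q` puts the big side of `q` inside its finite separator.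
  · rintro rfl
    refine τ.infinite_snd hq ((τ.isSeparation hq).1.subset fun v hv => ⟨?_, hv⟩)
    rcases hp.mem_or v with h | h
    · exact hpq.2 h
    · exact h
  · intro h
    rw [Prod.swap_swap] at h
    exact hpn (h ▸ hq)

/-- Otherwise `p`, the inverse of the supremum, and `(q.1 ∩ p.2, q.2 ∪ p.1)`, which lies below `q`,
form a star in `τ` whose interior is contained in the two separators. -/
theorem Tangle.sup_mem {p q : Set V × Set V} (hp : p ∈ τ.1) (hq : q ∈ τ.1) :
    (p.1 ∪ q.1, p.2 ∩ q.2) ∈ τ.1 := by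
  have sp := τ.isSeparation hp
  have sq := τ.isSeparation hq
  by_contra hn
  have hr : (p.2 ∩ q.2, p.1 ∪ q.1) ∈ τ.1 := (τ.mem_or_swap_mem (sp.sup sq)).resolve_left hn
  have hs : (q.1 ∩ p.2, q.2 ∪ p.1) ∈ τ.1 :=
    τ.mem_of_le hq (sq.swap.sup sp).swap ⟨inter_subset_left, subset_union_left⟩
  refine τ.2.2.2 {p, (q.1 ∩ p.2, q.2 ∪ p.1), (p.2 ∩ q.2, p.1 ∪ q.1)} ?_ ⟨?_, ?_, ?_, ?_⟩
  · rintro x (rfl | rfl | rfl) <;> assumption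
  · rintro x (rfl | rfl | rfl)
    exacts [sp, τ.isSeparation hs, τ.isSeparation hr]
  · rintro x (rfl | rfl | rfl) y (rfl | rfl | rfl) hxy <;>
      first
      | exact absurd rfl hxy
      | (constructor <;> intro v hv <;> simp only [mem_union, mem_inter_iff, Prod.fst_swap,
          Prod.snd_swap] at hv ⊢ <;> tauto)
  · exact toFinite _
  · refine (sp.1.union sq.1).subset fun v hv => ?_
    simp only [starInterior, mem_iInter] at hv
    have h₁ := hv p (by simp)
    have h₂ := hv (q.1 ∩ p.2, q.2 ∪ p.1) (by simp)
    have h₃ := hv (p.2 ∩ q.2, p.1 ∪ q.1) (by simp)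
    simp only [mem_union, mem_inter_iff] at h₁ h₂ h₃ ⊢
    tauto

/-- Up to finitely many vertices, membership in a tangle only depends on the strict big side. -/
theorem Tangle.mem_of_finite {p q : Set V × Set V} (hp : p ∈ τ.1) (hq : IsSeparation G q)
    (h : ((p.2 \ p.1) ∩ (q.1 \ q.2)).Finite) : q ∈ τ.1 := by
  by_contra hn
  have hs := (τ.mem_or_swap_mem hq).resolve_left hn
  -- Outside the two separators, the big side of the supremum of `p` and `q.swap` is the finite set
  -- of `h`.
  refine τ.infinite_snd (τ.sup_mem hp hs) ((((τ.isSeparation hp).1.union hq.1).union h).subset ?_)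
  rintro v ⟨h₁, h₂⟩
  simp only [Prod.snd_swap] at h₂
  simp only [mem_union, mem_inter_iff, Set.mem_sdiff]
  tauto

theorem Tangle.infinite_diff {p : Set V × Set V} (hp : p ∈ τ.1) : (p.2 \ p.1).Infinite := by
  intro h
  refine τ.infinite_snd hp ((h.union (τ.isSeparation hp).1).subset fun v hv => ?_)
  simp only [mem_union, mem_inter_iff, Set.mem_sdiff]
  tauto

end TangleBasics

/-! ### Components of G - X and the separations they define -/

section Components

theorem mem_verts {X : Set V} {𝓒 : Set (G.ComponentCompl X)} {v : V} :
    v ∈ verts 𝓒 ↔ ∃ C ∈ 𝓒, v ∈ C := by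
  simp [verts]

theorem ComponentCompl.eq_of_mem {X : Set V} {C D : G.ComponentCompl X} {v : V}
    (hC : v ∈ C) (hD : v ∈ D) : C = D := by
  obtain ⟨h, rfl⟩ := hC
  obtain ⟨h', rfl⟩ := hD
  rfl

/-- A set that meets a component, and that is closed under passing to neighbours inside the
component, contains the whole component. -/
theorem ComponentCompl.subset_of_closed {X : Set V} (C : G.ComponentCompl X) {S : Set V} {u : V}
    (huC : u ∈ C) (huS : u ∈ S)
    (h : ∀ v w, v ∈ C → v ∈ S → w ∈ C → G.Adj v w → w ∈ S) : (C : Set V) ⊆ S := by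
  intro w hw
  obtain ⟨hu, rfl⟩ := huC
  obtain ⟨hwX, hwC⟩ := hw
  have key : ∀ (a b : (Xᶜ : Set V)) (p : (G.induce Xᶜ).Walk a b),
      (a : V) ∈ G.componentComplMk hu → (a : V) ∈ S → (b : V) ∈ S := by
    intro a b p
    induction p with
    | nil => exact fun _ h => h
    | @cons a b c hab p ih =>
      intro ha haS
      have hb : (b : V) ∈ G.componentComplMk hu :=
        SimpleGraph.ComponentCompl.mem_of_adj _ _ ha b.2 hab
      exact ih hb (h _ _ ha haS hb hab)
  obtain ⟨p⟩ := ConnectedComponent.exact hwC.symm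
  exact key _ _ p ⟨hu, rfl⟩ huS

theorem ComponentCompl.exists_walk {X : Set V} (C : G.ComponentCompl X) {u v : V}
    (hu : u ∈ C) (hv : v ∈ C) : ∃ p : G.Walk u v, ∀ w ∈ p.support, w ∈ C := by
  refine ComponentCompl.subset_of_closed C
    (S := {v | ∃ p : G.Walk u v, ∀ w ∈ p.support, w ∈ C}) hu ⟨.nil, by simpa using hu⟩ ?_ hv
  rintro v w - ⟨p, hp⟩ hw hvw
  refine ⟨p.concat hvw, fun x hx => ?_⟩
  rw [Walk.support_concat, List.mem_append, List.mem_singleton] at hx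
  rcases hx with hx | rfl
  exacts [hp x hx, hw]

/-- A component that avoids the separator lies strictly on one of the two sides. -/
theorem ComponentCompl.subset_diff_or {X : Set V} (C : G.ComponentCompl X) {p : Set V × Set V}
    (hp : IsSeparation G p) (hC : Disjoint (C : Set V) (p.1 ∩ p.2)) :
    (C : Set V) ⊆ p.2 \ p.1 ∨ (C : Set V) ⊆ p.1 \ p.2 := by
  obtain ⟨u, hu⟩ := C.nonempty
  have aux : ∀ q : Set V × Set V, IsSeparation G q → Disjoint (C : Set V) (q.1 ∩ q.2) →
      u ∈ q.2 → (C : Set V) ⊆ q.2 \ q.1 := by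
    intro q hq hCq huq
    refine ComponentCompl.subset_of_closed C hu
      ⟨huq, fun h => disjoint_left.1 hCq hu ⟨h, huq⟩⟩ fun v w hv hvS hw hvw => ?_
    by_contra hn
    have hw' : w ∈ q.1 \ q.2 := by
      have h₁ := disjoint_left.1 hCq hw
      have h₂ := hq.mem_or w
      simp only [mem_inter_iff, Set.mem_sdiff] at *
      tauto
    exact hq.2.2 w hw' v hvS hvw.symm
  rcases hp.mem_or u with h | h
  · exact Or.inr (aux p.swap hp.swap (by simpa [inter_comm] using hC) h)
  · exact Or.inl (aux p hp hC h)

theorem isSeparation_sepTo {X : Finset V} (𝓒 : Set (G.ComponentCompl (X : Set V))) :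
    IsSeparation G (sepTo 𝓒) := by
  refine ⟨X.finite_toSet.subset ?_, ?_, ?_⟩
  · rintro v ⟨h₁, h₂ | h₂⟩
    exacts [h₂, absurd h₂ h₁]
  · refine eq_univ_of_forall fun v => ?_
    by_cases h : v ∈ verts 𝓒
    exacts [Or.inr (Or.inr h), Or.inl h]
  · rintro a ⟨ha, ha'⟩ b ⟨-, hb⟩ hab
    obtain ⟨C, hC, hbC⟩ := mem_verts.1 (not_not.1 hb)
    exact ha (mem_verts.2 ⟨C, hC, SimpleGraph.ComponentCompl.mem_of_adj _ _ hbC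
      (fun h => ha' (Or.inl h)) hab.symm⟩)

theorem sepTo_snd_diff {X : Finset V} (𝓒 : Set (G.ComponentCompl (X : Set V))) :
    (sepTo 𝓒).2 \ (sepTo 𝓒).1 = verts 𝓒 := by
  ext v
  simp only [sepTo, Set.mem_sdiff, mem_union, mem_compl_iff, not_not]
  tauto

theorem sepTo_fst_diff {X : Finset V} (𝓒 : Set (G.ComponentCompl (X : Set V))) :
    (sepTo 𝓒).1 \ (sepTo 𝓒).2 = verts 𝓒ᶜ := by
  ext v
  simp only [sepTo, Set.mem_sdiff, mem_union, mem_compl_iff, not_or]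
  constructor
  · rintro ⟨h₁, h₂, -⟩
    exact mem_verts.2 ⟨G.componentComplMk h₂, fun h => h₁ (mem_verts.2 ⟨_, h, h₂, rfl⟩), h₂, rfl⟩
  · intro h
    obtain ⟨C, hC, hvC⟩ := mem_verts.1 h
    have h' : v ∉ verts 𝓒 := fun hv => by
      obtain ⟨D, hD, hvD⟩ := mem_verts.1 hv
      exact hC (ComponentCompl.eq_of_mem hvC hvD ▸ hD)
    exact ⟨h', C.notMem_of_mem hvC, h'⟩

/-- Lets components of G - X with neighbourhood Y be reused as components of G - Y. -/
theorem exists_componentCompl_of_nbhd_subset {X Y : Set V} (C : G.ComponentCompl X)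
    (hC : Disjoint (C : Set V) Y) (hY : nbhd G (C : Set V) ⊆ Y) :
    ∃ D : G.ComponentCompl Y, (D : Set V) = C := by
  obtain ⟨u, hu⟩ := C.nonempty
  have huY := disjoint_left.1 hC hu
  refine ⟨G.componentComplMk huY, subset_antisymm ?_ ?_⟩
  · refine ComponentCompl.subset_of_closed _ ⟨huY, rfl⟩ hu fun v w _ hvC hw hvw => ?_
    by_contra hwC
    exact hw.1 (hY ⟨hwC, v, hvC, hvw⟩)
  · exact ComponentCompl.subset_of_closed C hu ⟨huY, rfl⟩ fun v w _ hv hw hvw =>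
      SimpleGraph.ComponentCompl.mem_of_adj _ _ hv (disjoint_left.1 hC hw) hvw

theorem nbhd_subset {X : Set V} (C : G.ComponentCompl X) : nbhd G (C : Set V) ⊆ X := by
  rintro v ⟨hv, u, hu, huv⟩
  by_contra h
  exact hv (SimpleGraph.ComponentCompl.mem_of_adj _ _ hu h huv)

theorem disjoint_nbhd (C : Set V) : Disjoint C (nbhd G C) :=
  disjoint_right.2 fun _ h => h.1

end Components

/-! ### The ultrafilters U(τ, X) -/

section Ultra

variable (τ : Tangle G)

theorem Tangle.mem_ultra_of_finite {p : Set V × Set V} (hp : p ∈ τ.1) {X : Finset V}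
    {𝓒 : Set (G.ComponentCompl (X : Set V))} (h : ((p.2 \ p.1) \ verts 𝓒).Finite) :
    𝓒 ∈ τ.ultra X :=
  τ.mem_of_finite hp (isSeparation_sepTo 𝓒) (h.subset (by
    rw [← sepTo_snd_diff]
    exact fun v hv => ⟨hv.1, fun h => h.2 hv.2.1⟩))

/-- Here `X` and `Y` may differ: comparing vertex sets is what relates the ultrafilters of one
tangle at different finite sets. -/
theorem Tangle.mem_ultra_of_subset {X Y : Finset V} {𝓒 : Set (G.ComponentCompl (X : Set V))}
    {𝓓 : Set (G.ComponentCompl (Y : Set V))} (h𝓒 : 𝓒 ∈ τ.ultra X) (h : verts 𝓒 ⊆ verts 𝓓) :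
    𝓓 ∈ τ.ultra Y :=
  τ.mem_ultra_of_finite h𝓒 (by rw [sepTo_snd_diff, sdiff_eq_empty.2 h]; exact finite_empty)

theorem Tangle.verts_inter_infinite {X Y : Finset V} {𝓒 : Set (G.ComponentCompl (X : Set V))}
    {𝓓 : Set (G.ComponentCompl (Y : Set V))} (h𝓒 : 𝓒 ∈ τ.ultra X) (h𝓓 : 𝓓 ∈ τ.ultra Y) :
    (verts 𝓒 ∩ verts 𝓓).Infinite := by
  refine (τ.infinite_diff (τ.sup_mem h𝓒 h𝓓)).mono ?_
  rw [← sepTo_snd_diff 𝓒, ← sepTo_snd_diff 𝓓]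
  rintro v ⟨⟨h₁, h₂⟩, h₃⟩
  exact ⟨⟨h₁, fun h => h₃ (Or.inl h)⟩, h₂, fun h => h₃ (Or.inr h)⟩

theorem verts_mono {X : Set V} {𝓒 𝓓 : Set (G.ComponentCompl X)} (h : 𝓒 ⊆ 𝓓) :
    verts 𝓒 ⊆ verts 𝓓 := biUnion_subset_biUnion_left h

theorem Tangle.compl_mem_ultra_iff {X : Finset V} {𝓒 : Set (G.ComponentCompl (X : Set V))} :
    𝓒ᶜ ∉ τ.ultra X ↔ 𝓒 ∈ τ.ultra X := by
  constructor
  · intro h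
    by_contra hn
    have hs := (τ.mem_or_swap_mem (isSeparation_sepTo 𝓒)).resolve_left hn
    refine h (τ.mem_ultra_of_finite hs ?_)
    rw [Prod.snd_swap, Prod.fst_swap, sepTo_fst_diff, sdiff_self]
    exact finite_empty
  · intro h h'
    obtain ⟨v, hv, hv'⟩ := (τ.verts_inter_infinite h h').nonempty
    rw [← sepTo_fst_diff] at hv'
    exact hv'.1 hv

theorem Tangle.inter_mem_ultra {X : Finset V} {𝓒 𝓓 : Set (G.ComponentCompl (X : Set V))}
    (h𝓒 : 𝓒 ∈ τ.ultra X) (h𝓓 : 𝓓 ∈ τ.ultra X) : 𝓒 ∩ 𝓓 ∈ τ.ultra X := by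
  refine τ.mem_ultra_of_finite (τ.sup_mem h𝓒 h𝓓) ?_
  convert finite_empty
  refine sdiff_eq_empty.2 ?_
  rintro v ⟨⟨h₁, h₂⟩, h₃⟩
  have hC : v ∈ verts 𝓒 := by
    rw [← sepTo_snd_diff]; exact ⟨h₁, fun h => h₃ (Or.inl h)⟩
  have hD : v ∈ verts 𝓓 := by
    rw [← sepTo_snd_diff]; exact ⟨h₂, fun h => h₃ (Or.inr h)⟩
  obtain ⟨C, hC, hvC⟩ := mem_verts.1 hC
  obtain ⟨D, hD, hvD⟩ := mem_verts.1 hD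
  obtain rfl := ComponentCompl.eq_of_mem hvC hvD
  exact mem_verts.2 ⟨C, ⟨hC, hD⟩, hvC⟩

theorem Tangle.univ_mem_ultra (X : Finset V) : univ ∈ τ.ultra X := by
  by_contra h
  have h' := not_not.1 (τ.compl_mem_ultra_iff.not.2 h)
  rw [compl_univ] at h'
  obtain ⟨v, hv, -⟩ := (τ.verts_inter_infinite h' h').nonempty
  simp [verts] at hv

/-- `U(τ, X)` as an `Ultrafilter`. -/
def Tangle.ultrafilter (X : Finset V) : Ultrafilter (G.ComponentCompl (X : Set V)) :=
  Ultrafilter.ofComplNotMemIff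
    { sets := τ.ultra X
      univ_sets := τ.univ_mem_ultra X
      sets_of_superset := fun h hs => τ.mem_ultra_of_subset h (verts_mono hs)
      inter_sets := fun h h' => τ.inter_mem_ultra h h' }
    fun _ => τ.compl_mem_ultra_iff

theorem Tangle.mem_ultrafilter {X : Finset V} {𝓒 : Set (G.ComponentCompl (X : Set V))} :
    𝓒 ∈ τ.ultrafilter X ↔ 𝓒 ∈ τ.ultra X := Iff.rfl

theorem Tangle.infinite_of_mem_ultra {X : Finset V} (hX : X ∈ τ.freeSets)
    {𝓒 : Set (G.ComponentCompl (X : Set V))} (h : 𝓒 ∈ τ.ultra X) : 𝓒.Infinite := by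
  intro hfin
  obtain ⟨C, -, hC⟩ := Ultrafilter.eq_pure_of_finite_mem hfin (τ.mem_ultrafilter.2 h)
  refine hX C (τ.mem_ultrafilter.1 ?_)
  rw [hC]
  exact mem_singleton C

end Ultra

/-! ### Existence and criticality of X_τ -/

section LeastFreeSet

variable {τ : Tangle G}

/-- If almost all components, with respect to the free ultrafilter `U(τ, Y)`, have
neighbourhood exactly `Y`, then `Y = X_τ`. -/
theorem Tangle.isX_of_nbhd_mem_ultra {Y : Finset V} (hY : Y ∈ τ.freeSets)
    (h : {D : G.ComponentCompl (Y : Set V) | nbhd G (D : Set V) = Y} ∈ τ.ultra Y) :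
    τ.IsX Y := by
  refine ⟨hY, fun X hX y hy => ?_⟩
  by_contra hyX
  have hyX' : y ∉ (X : Set V) := hyX
  -- Each vertex of `X` lies in at most one component of G - Y, so only finitely many components
  -- meet `X`.
  set 𝓜 := {D : G.ComponentCompl (Y : Set V) | ¬ Disjoint (D : Set V) X} with h𝓜
  have hfin : 𝓜.Finite := by
    have : (⋃ x ∈ (X : Set V), {D : G.ComponentCompl (Y : Set V) | x ∈ D}).Finite :=
      X.finite_toSet.biUnion fun x _ => Set.Subsingleton.finite
        fun C hC D hD => ComponentCompl.eq_of_mem hC hD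
    refine this.subset fun D hD => ?_
    obtain ⟨x, hxD, hxX⟩ := not_disjoint_iff.1 hD
    exact mem_biUnion hxX hxD
  have hcompl : 𝓜ᶜ ∈ τ.ultra Y := by
    have : 𝓜 ∉ τ.ultra Y := fun h' => τ.infinite_of_mem_ultra hY h' hfin
    by_contra hn
    exact this (τ.compl_mem_ultra_iff.1 hn)
  -- Almost all components of G - Y avoid `X` and have `y` as a neighbour, so they lie in the
  -- component of G - X containing `y`; its singleton contradicts freeness.
  refine hX (G.componentComplMk hyX') (τ.mem_ultra_of_subset (τ.inter_mem_ultra h hcompl) ?_)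
  intro v hv
  obtain ⟨D, ⟨hD, hDM⟩, hvD⟩ := mem_verts.1 hv
  have hdisj : Disjoint (D : Set V) X := not_not.1 hDM
  refine mem_verts.2 ⟨_, rfl, ?_⟩
  have hyD : y ∈ nbhd G (D : Set V) := by
    rw [show nbhd G (D : Set V) = Y from hD]
    exact hy
  obtain ⟨-, u, huD, huy⟩ := hyD
  have hu := SimpleGraph.ComponentCompl.mem_of_adj _ _ (G.componentComplMk_mem hyX')
    (disjoint_left.1 hdisj huD) huy.symm
  exact ComponentCompl.subset_of_closed D huD (S := G.componentComplMk hyX') hu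
    (fun v w _ hv hw hvw => SimpleGraph.ComponentCompl.mem_of_adj _ _ hv
      (disjoint_left.1 hdisj hw) hvw) hvD

/-- Neighbourhoods sort the components of G - X into finitely many classes, one of which belongs to
the ultrafilter. -/
theorem Tangle.exists_nbhd_mem_ultra (h : τ.IsUltrafilterTangle) :
    ∃ Y ∈ τ.freeSets,
      {D : G.ComponentCompl (Y : Set V) | nbhd G (D : Set V) = Y} ∈ τ.ultra Y := by
  classical
  obtain ⟨X, hX⟩ := h
  have hcover : (⋃ Y ∈ (X.powerset : Set (Finset V)),
      {C : G.ComponentCompl (X : Set V) | nbhd G (C : Set V) = Y}) ∈ τ.ultrafilter X := by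
    refine mem_of_superset univ_mem fun C _ => ?_
    obtain ⟨Y, hY⟩ := (X.finite_toSet.subset (nbhd_subset C)).exists_finset_coe
    refine mem_biUnion (x := Y) ?_ hY.symm
    rw [Finset.mem_coe, Finset.mem_powerset, ← Finset.coe_subset, hY]
    exact nbhd_subset C
  obtain ⟨Y, -, hY⟩ := (Ultrafilter.finite_biUnion_mem_iff (Finset.finite_toSet _)).1 hcover
  rw [τ.mem_ultrafilter] at hY
  have hex : ∀ C : G.ComponentCompl (X : Set V), nbhd G (C : Set V) = Y →
      ∃ D : G.ComponentCompl (Y : Set V), (D : Set V) = C := fun C hC =>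
    exists_componentCompl_of_nbhd_subset C (hC ▸ disjoint_nbhd _) hC.subset
  refine ⟨Y, fun D hD => ?_, τ.mem_ultra_of_subset hY ?_⟩
  -- If `{D} ∈ U(τ, Y)`, then `D` meets, and so equals, a selected component `C` of G - X, whence
  -- `{C} ∈ U(τ, X)`.
  · obtain ⟨v, hv, hv'⟩ := (τ.verts_inter_infinite hY hD).nonempty
    obtain ⟨C, hC, hvC⟩ := mem_verts.1 hv
    obtain ⟨D', rfl, hvD⟩ := mem_verts.1 hv'
    obtain ⟨E, hE⟩ := hex C hC
    have hvE : v ∈ E := by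
      rw [← SetLike.mem_coe, hE]
      exact hvC
    obtain rfl := ComponentCompl.eq_of_mem hvE hvD
    refine hX C (τ.mem_ultra_of_subset hD fun w hw => ?_)
    simpa [verts, hE] using hw
  · intro v hv
    obtain ⟨C, hC, hvC⟩ := mem_verts.1 hv
    obtain ⟨E, hE⟩ := hex C hC
    refine mem_verts.2 ⟨E, ?_, ?_⟩
    · change nbhd G (E : Set V) = Y
      rw [hE]
      exact hC
    · rw [← SetLike.mem_coe, hE]
      exact hvC

theorem Tangle.exists_isX (h : τ.IsUltrafilterTangle) : ∃ X : Finset V, τ.IsX X := by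
  obtain ⟨Y, hY, hY'⟩ := τ.exists_nbhd_mem_ultra h
  exact ⟨Y, isX_of_nbhd_mem_ultra hY hY'⟩

theorem Tangle.IsX.isCritical {X : Finset V} (h : τ.IsX X) : IsCritical G X := by
  obtain ⟨Y, hY, hY'⟩ := τ.exists_nbhd_mem_ultra ⟨X, h.1⟩
  obtain rfl := h.unique (isX_of_nbhd_mem_ultra hY hY')
  exact τ.infinite_of_mem_ultra hY hY'

end LeastFreeSet

/-! ### Tangles from free ultrafilters on the vertex set -/

section OfUltrafilter

/-- The separations whose strict big side belongs to a given ultrafilter on the vertex set. -/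
def ultrafilterSeps (G : SimpleGraph V) (𝒲 : Ultrafilter V) : Set (Set V × Set V) :=
  {p | IsSeparation G p ∧ p.2 \ p.1 ∈ 𝒲}

theorem notMem_of_finite {𝒲 : Ultrafilter V} (h : (𝒲 : Filter V) ≤ cofinite) {s : Set V}
    (hs : s.Finite) : s ∉ 𝒲 :=
  Ultrafilter.compl_mem_iff_notMem.1 (h hs.compl_mem_cofinite)

/-- Separators are finite, so exactly one strict side is in `𝒲`. Sets in `𝒲` meet, which gives
consistency; the interior of a finite star contains a finite intersection of such sets, so it is
infinite. -/
theorem isTangle_ultrafilterSeps {𝒲 : Ultrafilter V} (h : (𝒲 : Filter V) ≤ cofinite) :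
    IsTangle G (finiteStars G) (ultrafilterSeps G 𝒲) := by
  refine ⟨⟨fun p hp => hp.1, fun p hp => ?_⟩, ?_, ?_⟩
  · have hdisj : p.2 \ p.1 ∈ 𝒲 → p.1 \ p.2 ∉ 𝒲 := fun h₁ h₂ => by
      obtain ⟨v, hv, hv'⟩ := 𝒲.nonempty_of_mem (inter_mem h₁ h₂)
      exact hv.2 hv'.1
    have hor : p.2 \ p.1 ∈ 𝒲 ∨ p.1 \ p.2 ∈ 𝒲 := by
      rw [← Ultrafilter.union_mem_iff]
      refine mem_of_superset (h hp.1.compl_mem_cofinite) fun v hv => ?_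
      have := hp.mem_or v
      simp only [mem_compl_iff, mem_inter_iff, mem_union, Set.mem_sdiff] at hv ⊢
      tauto
    rcases hor with h' | h'
    · exact Or.inl ⟨⟨hp, h'⟩, fun hs => hdisj h' hs.2⟩
    · exact Or.inr ⟨⟨hp.swap, h'⟩, fun hs => hdisj hs.2 h'⟩
  · rintro p hp q hq - ⟨⟨h₁, h₂⟩, -⟩
    obtain ⟨v, hv, hv'⟩ := 𝒲.nonempty_of_mem (inter_mem hp.2 hq.2)
    exact hv'.2 (h₁ hv.1)
  · rintro σ hσ ⟨-, -, hfin, hint⟩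
    refine notMem_of_finite h hint ((biInter_mem hfin).2 fun p hp => ?_)
    exact mem_of_superset (hσ hp).2 sdiff_subset

/-- The tangle induced by a free ultrafilter on the vertex set. -/
def tangleOfUltrafilter (G : SimpleGraph V) {𝒲 : Ultrafilter V}
    (h : (𝒲 : Filter V) ≤ cofinite) : Tangle G :=
  ⟨ultrafilterSeps G 𝒲, isTangle_ultrafilterSeps h⟩

theorem mem_ultra_tangleOfUltrafilter {𝒲 : Ultrafilter V} (h : (𝒲 : Filter V) ≤ cofinite)
    {X : Finset V} {𝓒 : Set (G.ComponentCompl (X : Set V))} :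
    𝓒 ∈ (tangleOfUltrafilter G h).ultra X ↔ verts 𝓒 ∈ 𝒲 := by
  rw [← sepTo_snd_diff]
  exact and_iff_right (isSeparation_sepTo 𝓒)

/-- Every critical vertex set is of the form `X_τ`. -/
theorem IsCritical.exists_isX {X : Finset V} (hX : IsCritical G X) :
    ∃ τ : Tangle G, τ.IsX X := by
  have := hX.cofinite_inf_principal_neBot
  set 𝒰 := Ultrafilter.of (cofinite ⊓ 𝓟 {C : G.ComponentCompl (X : Set V) |
    nbhd G (C : Set V) = (X : Set V)})
  have h𝒰 := le_inf_iff.1 (Ultrafilter.of_le (cofinite ⊓ 𝓟 {C : G.ComponentCompl (X : Set V) |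
    nbhd G (C : Set V) = (X : Set V)}))
  -- One representative vertex per component carries the free ultrafilter over to `V`.
  choose g hg using fun C : G.ComponentCompl (X : Set V) => C.nonempty
  have hinj : Function.Injective g := fun C D h =>
    ComponentCompl.eq_of_mem (hg C) (h ▸ hg D)
  have hfree : ((𝒰.map g : Ultrafilter V) : Filter V) ≤ cofinite :=
    (map_mono h𝒰.1).trans hinj.tendsto_cofinite
  have key : ∀ 𝓒 : Set (G.ComponentCompl (X : Set V)),
      𝓒 ∈ (tangleOfUltrafilter G hfree).ultra X ↔ 𝓒 ∈ 𝒰 := fun 𝓒 => by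
    rw [mem_ultra_tangleOfUltrafilter, Ultrafilter.mem_map]
    suffices g ⁻¹' verts 𝓒 = 𝓒 by rw [this]
    ext C
    refine ⟨fun h => ?_, fun h => mem_verts.2 ⟨C, h, hg C⟩⟩
    obtain ⟨D, hD, hgD⟩ := mem_verts.1 h
    exact ComponentCompl.eq_of_mem (hg C) hgD ▸ hD
  refine ⟨tangleOfUltrafilter G hfree, Tangle.isX_of_nbhd_mem_ultra (fun C hC => ?_)
    ((key _).2 (le_principal_iff.1 h𝒰.2))⟩
  exact notMem_of_finite h𝒰.1 (finite_singleton C) ((key _).1 hC)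

end OfUltrafilter

/-! ### Tangles of ends -/

section EndTangles

theorem Ray.hasTailIn_iff {r : Ray G} {X : Set V} {C : G.ComponentCompl X} :
    r.HasTailIn C ↔ ∀ᶠ n in atTop, r.toFun n ∈ C :=
  eventually_atTop.symm

theorem Ray.tendsto_cofinite (r : Ray G) : Tendsto r.toFun atTop cofinite :=
  Nat.cofinite_eq_atTop ▸ r.injective.tendsto_cofinite

theorem GEnd.livesIn_mk_iff {r : Ray G} {X : Finset V} {C : G.ComponentCompl (X : Set V)} :
    GEnd.LivesIn (Quotient.mk (raySetoid G) r : GEnd G) C ↔ r.HasTailIn C := by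
  refine ⟨fun h => h r rfl, fun h s hs => ?_⟩
  obtain ⟨D, hsD, hrD⟩ := (Quotient.exact hs : (raySetoid G) s r) X
  exact h.unique hrD ▸ hsD

theorem GEnd.exists_livesIn_mk (r : Ray G) {X : Set V} (hX : X.Finite) :
    ∃ C : G.ComponentCompl X, r.HasTailIn C ∧
      GEnd.LivesIn (Quotient.mk (raySetoid G) r : GEnd G) C := by
  lift X to Finset V using hX
  obtain ⟨C, hC⟩ := r.exists_hasTailIn X
  exact ⟨C, hC, livesIn_mk_iff.2 hC⟩

theorem GEnd.mem_tangleSet_mk_iff {r : Ray G} {p : Set V × Set V} :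
    p ∈ GEnd.tangleSet (Quotient.mk (raySetoid G) r : GEnd G) ↔
      IsSeparation G p ∧ ∀ᶠ n in atTop, r.toFun n ∈ p.2 \ p.1 := by
  refine and_congr_right fun hp => ⟨?_, fun h => ?_⟩
  · rintro ⟨C, hC, hCp⟩
    exact (Ray.hasTailIn_iff.1 (hC r rfl)).mono fun n hn => hCp hn
  · obtain ⟨C, hrC, hC⟩ := GEnd.exists_livesIn_mk r hp.1
    refine ⟨C, hC, ?_⟩
    rcases ComponentCompl.subset_diff_or C hp C.disjoint_right.symm with h' | h'
    · exact h'
    · obtain ⟨n, hn, hn'⟩ := (h.and (Ray.hasTailIn_iff.1 hrC)).exists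
      exact absurd hn.1 (h' hn').2

theorem GEnd.isTangle_tangleSet (ω : GEnd G) : IsTangle G (finiteStars G) ω.tangleSet := by
  induction ω using Quotient.ind with
  | _ r =>
  -- Any ultrafilter containing the tails of `r` will do: the component in which `r` has a tail lies
  -- on one strict side, so the ultrafilter and `r` choose the same side.
  have hle := Ultrafilter.of_le (map r.toFun atTop)
  convert isTangle_ultrafilterSeps (G := G) (hle.trans r.tendsto_cofinite) using 1
  ext p
  rw [mem_tangleSet_mk_iff]
  refine and_congr_right fun hp => ⟨fun h => hle h, fun h => ?_⟩
  obtain ⟨C, hrC, -⟩ := GEnd.exists_livesIn_mk r hp.1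
  have hev := Ray.hasTailIn_iff.1 hrC
  rcases ComponentCompl.subset_diff_or C hp C.disjoint_right.symm with h' | h'
  · exact hev.mono fun n hn => h' hn
  · obtain ⟨v, hv, hv'⟩ := Ultrafilter.nonempty_of_mem (inter_mem h (hle (mem_map.2 hev)))
    exact absurd hv.1 (h' hv').2

/-- The end tangle `τ_ω`. -/
def GEnd.tangle (ω : GEnd G) : Tangle G := ⟨ω.tangleSet, ω.isTangle_tangleSet⟩

theorem GEnd.singleton_mem_ultra_iff {r : Ray G} {X : Finset V}
    {C : G.ComponentCompl (X : Set V)} :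
    {C} ∈ (GEnd.tangle (Quotient.mk (raySetoid G) r : GEnd G)).ultra X ↔ r.HasTailIn C := by
  rw [Ray.hasTailIn_iff]
  refine mem_tangleSet_mk_iff.trans ((and_iff_right (isSeparation_sepTo _)).trans ?_)
  rw [sepTo_snd_diff]
  simp [verts]

theorem GEnd.not_isUltrafilterTangle (ω : GEnd G) : ¬ ω.tangle.IsUltrafilterTangle := by
  induction ω using Quotient.ind with
  | _ r =>
  rintro ⟨X, hX⟩
  obtain ⟨C, hC⟩ := r.exists_hasTailIn X
  exact hX C (singleton_mem_ultra_iff.2 hC)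

theorem GEnd.tangle_injective : Function.Injective (GEnd.tangle : GEnd G → Tangle G) := by
  intro ω ω' h
  induction ω using Quotient.ind with
  | _ r =>
  induction ω' using Quotient.ind with
  | _ s =>
  refine Quotient.sound fun X => ?_
  obtain ⟨C, hC⟩ := r.exists_hasTailIn X
  exact ⟨C, hC, singleton_mem_ultra_iff.1 (h ▸ singleton_mem_ultra_iff.2 hC)⟩

/-- A tangle that agrees with an end on all sets `{C} ∈ U(τ, X)` is the tangle of this end. -/
theorem Tangle.eq_tangle_of_hasTailIn {τ : Tangle G} {r : Ray G}
    (h : ∀ X : Finset V, ∃ C : G.ComponentCompl (X : Set V), {C} ∈ τ.ultra X ∧ r.HasTailIn C) :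
    GEnd.tangle (Quotient.mk (raySetoid G) r : GEnd G) = τ := by
  have hsub : (GEnd.tangle (Quotient.mk (raySetoid G) r : GEnd G)).1 ⊆ τ.1 := by
    intro p hp
    obtain ⟨hsep, hev⟩ := GEnd.mem_tangleSet_mk_iff.1 hp
    obtain ⟨X, hX⟩ := hsep.1.exists_finset_coe
    obtain ⟨C, hC, hrC⟩ := h X
    rcases ComponentCompl.subset_diff_or C hsep (hX ▸ C.disjoint_right.symm) with h' | h'
    · refine τ.mem_of_finite hC hsep ?_
      convert finite_empty
      rw [sepTo_snd_diff, ← disjoint_iff_inter_eq_empty, Set.disjoint_left]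
      intro v hv hv'
      have hv : v ∈ C := by simpa [verts] using hv
      exact hv'.2 (h' hv).1
    · obtain ⟨n, hn, hn'⟩ := (hev.and (Ray.hasTailIn_iff.1 hrC)).exists
      exact absurd hn.1 (h' hn').2
  refine Subtype.ext (subset_antisymm hsub fun p hp => ?_)
  refine ((GEnd.tangle _).mem_or_swap_mem (τ.isSeparation hp)).resolve_right fun hs => ?_
  exact τ.swap_notMem hp (hsub hs)

end EndTangles

/-! ### Extracting rays from sequences of walks -/

section RayExtraction

/-- An infinite walk that visits each vertex only finitely often contains a ray, obtained by always
leaving a vertex after its last visit. -/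
theorem exists_ray_of_tendsto_cofinite {w : ℕ → V} (hadj : ∀ n, G.Adj (w n) (w (n + 1)))
    (hw : Tendsto w atTop cofinite) :
    ∃ (r : Ray G) (i : ℕ → ℕ), StrictMono i ∧ ∀ k, r.toFun k = w (i k) := by
  have hlast : ∀ n, ∃ l, w l = w n ∧ n ≤ l ∧ ∀ m > l, w m ≠ w n := by
    intro n
    have hfin : {m | w m = w n}.Finite := by
      have h := hw (finite_singleton (w n)).compl_mem_cofinite
      rw [← Nat.cofinite_eq_atTop, mem_map, mem_cofinite, ← preimage_compl, compl_compl] at h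
      exact h
    obtain ⟨l, hl, hmax⟩ := exists_max_image _ id hfin ⟨n, rfl⟩
    exact ⟨l, hl, hmax n rfl, fun m hm h => absurd (hmax m h) (not_le.2 hm)⟩
  choose l hwl hle hl using hlast
  let i : ℕ → ℕ := fun k => Nat.rec (l 0) (fun _ m => l (m + 1)) k
  have hi : StrictMono i := strictMono_nat_of_lt_succ fun k => hle (i k + 1)
  have hmax : ∀ k, ∀ m > i k, w m ≠ w (i k) := by
    rintro (_ | k) m hm
    · exact (hl 0 m hm).trans_eq (hwl 0).symm
    · exact (hl (i k + 1) m hm).trans_eq (hwl (i k + 1)).symm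
  refine ⟨⟨fun k => w (i k), ?_, fun k => ?_⟩, i, hi, fun k => rfl⟩
  · intro j k h
    rcases lt_trichotomy j k with hjk | hjk | hjk
    · exact absurd h.symm (hmax j (i k) (hi hjk))
    · exact hjk
    · exact absurd h (hmax k (i j) (hi hjk))
  · change G.Adj (w (i k)) (w (l (i k + 1)))
    rw [hwl]
    exact hadj _

/-- A concatenation of infinitely many finite walks, such that each vertex lies on only finitely
many of them, contains a ray. -/
theorem exists_ray_of_walks {x : ℕ → V} (P : ∀ n, G.Walk (x n) (x (n + 1)))
    (hne : ∀ n, x n ≠ x (n + 1)) (hfin : ∀ v, {n | v ∈ (P n).support}.Finite) :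
    ∃ r : Ray G, ∀ m, ∀ᶠ n in atTop, ∃ k ≥ m, r.toFun n ∈ (P k).support := by
  let W : ∀ n, G.Walk (x 0) (x n) := fun n => Nat.rec .nil (fun n p => p.append (P n)) n
  have hW : ∀ n, W (n + 1) = (W n).append (P n) := fun n => rfl
  have hlt : ∀ n, (W n).length < (W (n + 1)).length := fun n => by
    rw [hW, Walk.length_append, lt_add_iff_pos_right, Nat.pos_iff_ne_zero]
    exact fun h => hne n (Walk.eq_of_length_eq_zero h)
  have hmono : StrictMono fun n => (W n).length := strictMono_nat_of_lt_succ hlt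
  have hstable : ∀ m n, m ≤ n → ∀ i ≤ (W m).length, (W n).getVert i = (W m).getVert i := by
    intro m n hmn i hi
    induction n, hmn using Nat.le_induction with
    | base => rfl
    | succ n hmn ih =>
      rw [hW, Walk.getVert_append, ← ih]
      split_ifs with h
      · rfl
      · have : i = (W n).length := le_antisymm (hi.trans (hmono.monotone hmn)) (not_lt.1 h)
        rw [this, Nat.sub_self, Walk.getVert_zero, Walk.getVert_length]
  have hsupp : ∀ m n, m ≤ n → ∀ i, (W m).length ≤ i → i ≤ (W n).length →
      ∃ k ≥ m, (W n).getVert i ∈ (P k).support := by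
    intro m n hmn i hi
    induction n, hmn using Nat.le_induction with
    | base =>
      intro hi'
      rw [le_antisymm hi' hi, Walk.getVert_length]
      exact ⟨m, le_rfl, Walk.start_mem_support _⟩
    | succ n hmn ih =>
      intro _
      rcases le_or_gt i (W n).length with h | h
      · rw [hstable n (n + 1) n.le_succ i h]
        exact ih h
      · rw [hW, Walk.getVert_append, if_neg h.not_gt]
        exact ⟨n, hmn, Walk.getVert_mem_support _ _⟩
  -- The walks `W n` extend each other and have length at least `n`, so this diagonal is their
  -- limit.
  let w : ℕ → V := fun i => (W i).getVert i
  have hwW : ∀ n, ∀ i ≤ n, w i = (W n).getVert i := fun n i hin =>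
    (hstable i n hin i (hmono.id_le i)).symm
  have hwP : ∀ m, ∀ i ≥ (W m).length, ∃ k ≥ m, w i ∈ (P k).support := fun m i hi => by
    have := hmono.id_le m
    exact hsupp m i (this.trans hi) i hi (hmono.id_le i)
  have hadj : ∀ n, G.Adj (w n) (w (n + 1)) := fun n => by
    rw [hwW (n + 1) n n.le_succ]
    exact (W (n + 1)).adj_getVert_succ (hmono.id_le (n + 1))
  have htend : Tendsto w atTop cofinite := by
    refine le_cofinite_iff_eventually_ne.2 fun v => ?_
    obtain ⟨m, hm⟩ := (hfin v).bddAbove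
    refine eventually_map.2 (eventually_atTop.2 ⟨(W (m + 1)).length, fun i hi h => ?_⟩)
    obtain ⟨k, hk, hwk⟩ := hwP (m + 1) i hi
    have : k ≤ m := hm (show v ∈ (P k).support from h ▸ hwk)
    omega
  obtain ⟨r, i, hi, hr⟩ := exists_ray_of_tendsto_cofinite hadj htend
  refine ⟨r, fun m => ?_⟩
  filter_upwards [hi.tendsto_atTop.eventually_ge_atTop (W m).length] with n hn
  rw [hr]
  exact hwP m _ hn

theorem ComponentCompl.support_subset {X : Set V} (C : G.ComponentCompl X) {u v : V}
    (p : G.Walk u v) (hu : u ∈ C) (hp : ∀ w ∈ p.support, w ∉ X) : ∀ w ∈ p.support, w ∈ C := by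
  induction p with
  | nil => simpa using hu
  | @cons a b c h p ih =>
    intro w hw
    rw [Walk.support_cons, List.mem_cons] at hw
    rcases hw with rfl | hw
    · exact hu
    · refine ih ?_ (fun w hw => hp w (by simp [hw])) w hw
      exact SimpleGraph.ComponentCompl.mem_of_adj _ _ hu (hp b (by simp)) h

/-- Late walks avoid the finite set `X` and start in `f X`, so they stay there, and with them a tail
of the ray. -/
theorem exists_ray_hasTailIn {x : ℕ → V} (P : ∀ n, G.Walk (x n) (x (n + 1)))
    (hne : ∀ n, x n ≠ x (n + 1)) (hfin : ∀ v, {n | v ∈ (P n).support}.Finite)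
    (f : ∀ X : Finset V, G.ComponentCompl (X : Set V))
    (hx : ∀ X, ∀ᶠ n in atTop, x n ∈ f X) :
    ∃ r : Ray G, ∀ X, r.HasTailIn (f X) := by
  obtain ⟨r, hr⟩ := exists_ray_of_walks P hne hfin
  refine ⟨r, fun X => Ray.hasTailIn_iff.2 ?_⟩
  obtain ⟨m, hm⟩ := (X.finite_toSet.biUnion fun v _ => hfin v).bddAbove
  obtain ⟨m', hm'⟩ := eventually_atTop.1 (hx X)
  filter_upwards [hr (max (m + 1) m')] with n hn
  obtain ⟨k, hk, hrk⟩ := hn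
  refine ComponentCompl.support_subset _ (P k) (hm' k (le_trans (le_max_right _ _) hk))
    (fun v hv hvX => ?_) _ hrk
  have h₁ : k ≤ m := hm (mem_biUnion hvX hv)
  have h₂ : m + 1 ≤ k := le_trans (le_max_left _ _) hk
  omega

end RayExtraction

/-! ### Directions are induced by rays -/

section Directions

variable {f : ∀ X : Finset V, G.ComponentCompl (X : Set V)}

/-- Any two vertices of this set outside `S` lie in `f S`, so they are linked by a walk avoiding
`S`. The ray threads through infinitely many of them. -/
theorem exists_ray_of_infinite_dominating
    (hD : {v | ∀ X : Finset V, v ∉ X → v ∈ f X}.Infinite) :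
    ∃ r : Ray G, ∀ X, r.HasTailIn (f X) := by
  classical
  set D := {v | ∀ X : Finset V, v ∉ X → v ∈ f X} with hDdef
  -- In a state `(S, x)`, the set `S` holds the vertices used so far except `x`, where the next walk
  -- starts.
  have step : ∀ s : {s : Finset V × V // s.2 ∈ D ∧ s.2 ∉ s.1},
      ∃ (t : {s : Finset V × V // s.2 ∈ D ∧ s.2 ∉ s.1}) (p : G.Walk s.1.2 t.1.2),
        s.1.2 ≠ t.1.2 ∧ (∀ w ∈ p.support, w ∉ s.1.1) ∧ s.1.1 ⊆ t.1.1 ∧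
        ∀ w ∈ p.support, w ≠ t.1.2 → w ∈ t.1.1 := by
    rintro ⟨⟨S, x⟩, hx, hxS⟩
    obtain ⟨y, hy, hyS⟩ := hD.exists_notMem_finset (insert x S)
    rw [Finset.mem_insert, not_or] at hyS
    obtain ⟨p, hp⟩ := ComponentCompl.exists_walk (f S) (hx S hxS) (hy S hyS.2)
    refine ⟨⟨⟨(S ∪ p.support.toFinset).erase y, y⟩, hy, by simp⟩, p, Ne.symm hyS.1, ?_, ?_, ?_⟩
    · exact fun w hw => (f S).notMem_of_mem (hp w hw)
    · refine Finset.subset_erase.2 ⟨Finset.subset_union_left, hyS.2⟩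
    · intro w hw hwy
      exact Finset.mem_erase.2 ⟨hwy, Finset.mem_union_right _ (List.mem_toFinset.2 hw)⟩
  choose next P hne havoid hsub hmem using step
  obtain ⟨x₀, hx₀⟩ := hD.nonempty
  let s : ℕ → {s : Finset V × V // s.2 ∈ D ∧ s.2 ∉ s.1} := fun n =>
    Nat.rec ⟨⟨∅, x₀⟩, hx₀, Finset.notMem_empty _⟩ (fun _ t => next t) n
  have hmono : Monotone fun n => (s n).1.1 := monotone_nat_of_le_succ fun n => hsub (s n)
  have hfin : ∀ v, {n | v ∈ (P (s n)).support}.Finite := by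
    intro v
    rcases Set.eq_empty_or_nonempty {n | v ∈ (P (s n)).support} with h | ⟨m, hm⟩
    · rw [h]
      exact finite_empty
    -- The end of walk `m` starts walk `m + 1`, so it becomes forbidden one stage later than the
    -- other vertices.
    have hv : v ∈ (s (m + 2)).1.1 := by
      by_cases hvx : v = (s (m + 1)).1.2
      · refine hmem (s (m + 1)) v ?_ ?_
        · rw [hvx]
          exact Walk.start_mem_support _
        · rw [hvx]
          exact hne (s (m + 1))
      · exact hmono (m + 1).le_succ (hmem (s m) v hm hvx)
    refine (finite_lt_nat (m + 2)).subset fun n hn => ?_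
    change n < m + 2
    by_contra hlt
    exact havoid (s n) v hn (hmono (not_lt.1 hlt) hv)
  refine exists_ray_hasTailIn (x := fun n => (s n).1.2) (fun n => P (s n)) (fun n => hne (s n))
    hfin f fun X => ?_
  obtain ⟨m, hm⟩ := (X.finite_toSet.biUnion fun v _ => hfin v).bddAbove
  refine eventually_atTop.2 ⟨m + 1, fun n hn => (s n).2.1 X fun hX => ?_⟩
  have : n ≤ m := hm (mem_biUnion hX (Walk.start_mem_support (P (s n))))
  omega

/-- Each `v ∉ D` is excluded from `f (Y v)` by some `Y v` not containing it. Adding these sets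
repeatedly yields S_0 ⊆ S_1 ⊆ … such that the nested sets f(S_n) have empty intersection. -/
theorem exists_ray_of_finite_dominating (hf : ∀ X Y, X ⊆ Y → (f Y : Set V) ⊆ f X)
    (hD : {v | ∀ X : Finset V, v ∉ X → v ∈ f X}.Finite) :
    ∃ r : Ray G, ∀ X, r.HasTailIn (f X) := by
  classical
  obtain ⟨D, hD⟩ := hD.exists_finset_coe
  have hY : ∀ v, ∃ Y : Finset V, v ∉ D → v ∉ Y ∧ v ∉ f Y := by
    intro v
    by_cases hv : v ∈ D
    · exact ⟨∅, fun h => absurd hv h⟩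
    · have : ¬ ∀ X : Finset V, v ∉ X → v ∈ f X := fun h => by
        rw [← Finset.mem_coe, hD] at hv
        exact hv h
      push Not at this
      obtain ⟨Y, hY⟩ := this
      exact ⟨Y, fun _ => hY⟩
  choose Y hY using hY
  have step : ∀ s : {s : Finset V × V // D ⊆ s.1 ∧ s.2 ∈ f s.1},
      ∃ (t : {s : Finset V × V // D ⊆ s.1 ∧ s.2 ∈ f s.1}) (p : G.Walk s.1.2 t.1.2),
        (∀ w ∈ p.support, w ∈ f s.1.1) ∧ s.1.1 ⊆ t.1.1 ∧ s.1.2 ∉ f t.1.1 ∧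
        ∀ v ∈ s.1.1, v ∉ D → ∀ u ∈ f t.1.1, ¬ G.Adj u v := by
    rintro ⟨⟨S, x⟩, hDS, hx⟩
    have hxD : x ∉ D := fun h => (f S).notMem_of_mem hx (hDS h)
    let T := S ∪ (insert x S \ D).biUnion Y
    have hST : S ⊆ T := Finset.subset_union_left
    have hYT : ∀ v ∈ insert x S, v ∉ D → Y v ⊆ T := fun v hv hvD =>
      (Finset.subset_biUnion_of_mem Y (Finset.mem_sdiff.2 ⟨hv, hvD⟩)).trans
        Finset.subset_union_right
    obtain ⟨y, hy⟩ := (f T).nonempty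
    obtain ⟨p, hp⟩ := ComponentCompl.exists_walk (f S) hx (hf S T hST hy)
    refine ⟨⟨⟨T, y⟩, hDS.trans hST, hy⟩, p, hp, hST, fun h => ?_, fun v hv hvD u hu huv => ?_⟩
    · exact (hY x hxD).2 (hf _ T (hYT x (Finset.mem_insert_self _ _) hxD) h)
    · exact (hY v hvD).2 (SimpleGraph.ComponentCompl.mem_of_adj _ _
        (hf _ T (hYT v (Finset.mem_insert_of_mem hv) hvD) hu) (hY v hvD).1 huv)
  choose next P hP hsub hnot hnadj using step
  obtain ⟨x₀, hx₀⟩ := (f D).nonempty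
  let s : ℕ → {s : Finset V × V // D ⊆ s.1 ∧ s.2 ∈ f s.1} := fun n =>
    Nat.rec ⟨⟨D, x₀⟩, Finset.Subset.refl _, hx₀⟩ (fun _ t => next t) n
  have hmono : Monotone fun n => (s n).1.1 := monotone_nat_of_le_succ fun n => hsub (s n)
  have hanti : ∀ m n, m ≤ n → (f (s n).1.1 : Set V) ⊆ f (s m).1.1 := fun m n h =>
    hf _ _ (hmono h)
  -- Leaving spreads along edges inside `f D`: if `u ∉ f(S_n)` had a neighbour in f(S_{n+1}), then
  -- `u ∈ S_n \ D`, but such vertices send no edge to f(S_{n+1}).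
  have hleave : ∀ v, ∃ n, v ∉ f (s n).1.1 := by
    intro v
    by_cases hv : v ∈ f D
    · refine ComponentCompl.subset_of_closed (f D) (S := {v | ∃ n, v ∉ f (s n).1.1}) hx₀
        ⟨1, hnot (s 0)⟩ ?_ hv
      rintro u w hu ⟨n, hn⟩ - huw
      refine ⟨n + 1, fun hw => ?_⟩
      have huS : u ∈ (s n).1.1 := by
        by_contra h
        exact hn (SimpleGraph.ComponentCompl.mem_of_adj _ _ (hanti n (n + 1) n.le_succ hw) h
          huw.symm)
      exact hnadj (s n) u huS ((f D).notMem_of_mem hu) w hw huw.symm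
    · exact ⟨0, hv⟩
  have hfin : ∀ v, {n | v ∈ (P (s n)).support}.Finite := by
    intro v
    obtain ⟨m, hm⟩ := hleave v
    refine (finite_lt_nat m).subset fun n hn => ?_
    change n < m
    by_contra hlt
    exact hm (hanti m n (not_lt.1 hlt) (hP (s n) v hn))
  refine exists_ray_hasTailIn (x := fun n => (s n).1.2) (fun n => P (s n))
    (fun n h => hnot (s n) (?_ : (s n).1.2 ∈ f (s (n + 1)).1.1)) hfin f fun X => ?_
  · rw [show (s n).1.2 = (s (n + 1)).1.2 from h]
    exact (s (n + 1)).2.2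
  choose N hN using hleave
  refine eventually_atTop.2 ⟨X.sup N, fun n hn => ?_⟩
  have hdisj : ∀ v ∈ f (s n).1.1, v ∉ X := fun v hv hvX =>
    hN v (hanti _ n ((Finset.le_sup hvX).trans hn) hv)
  -- The component f(S_n) avoids `X`, and it meets `f X` because f(S_n ∪ X) lies in both; being
  -- connected, it lies inside `f X`.
  obtain ⟨u, hu⟩ := (f ((s n).1.1 ∪ X)).nonempty
  exact ComponentCompl.subset_of_closed (f (s n).1.1) (S := f X)
    (hf _ _ Finset.subset_union_left hu) (hf _ _ Finset.subset_union_right hu)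
    (fun v w _ hv hw hvw => SimpleGraph.ComponentCompl.mem_of_adj _ _ hv (hdisj w hw) hvw)
    (s n).2.2

/-- Every direction of a graph is induced by a ray. -/
theorem exists_ray_of_direction (hf : ∀ X Y, X ⊆ Y → (f Y : Set V) ⊆ f X) :
    ∃ r : Ray G, ∀ X, r.HasTailIn (f X) :=
  ({v | ∀ X : Finset V, v ∉ X → v ∈ f X}.finite_or_infinite).elim
    (exists_ray_of_finite_dominating hf) exists_ray_of_infinite_dominating

/-- Every tangle that is not an ultrafilter tangle is the tangle of an end. -/
theorem Tangle.exists_eq_tangle {τ : Tangle G} (hτ : ¬ τ.IsUltrafilterTangle) :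
    ∃ ω : GEnd G, ω.tangle = τ := by
  have h : ∀ X : Finset V, ∃ C : G.ComponentCompl (X : Set V), {C} ∈ τ.ultra X := by
    intro X
    by_contra! hX
    exact hτ ⟨X, hX⟩
  choose f hf using h
  obtain ⟨r, hr⟩ := exists_ray_of_direction (f := f) fun X Y hXY => by
    rw [← SimpleGraph.ComponentCompl.hom_eq_iff_le _ (Finset.coe_subset.2 hXY)]
    have h : {(f Y).hom (Finset.coe_subset.2 hXY)} ∈ τ.ultra X := by
      refine τ.mem_ultra_of_subset (hf Y) ?_
      simpa [verts] using (f Y).subset_hom (Finset.coe_subset.2 hXY)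
    obtain ⟨v, hv, hv'⟩ := (τ.verts_inter_infinite h (hf X)).nonempty
    simp only [verts, mem_singleton_iff, iUnion_iUnion_eq_left] at hv hv'
    exact ComponentCompl.eq_of_mem hv hv'
  exact ⟨_, Tangle.eq_tangle_of_hasTailIn fun X => ⟨f X, hf X, hr X⟩⟩

end Directions

/-! ### The topologies of the 1-complex and of |G|_Θ -/

section ComplexTopology

theorem continuous_edgeMap (e : G.edgeSet) : Continuous (edgeMap G e) :=
  continuous_iff_coinduced_le.2
    (le_iSup (fun e : G.edgeSet => TopologicalSpace.coinduced (edgeMap G e) inferInstance) e)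

theorem Complex.isOpen_iff {U : Set (Complex G)} :
    IsOpen U ↔ ∀ e : G.edgeSet, IsOpen (edgeMap G e ⁻¹' U) :=
  isOpen_iSup_iff.trans (forall_congr' fun _ => isOpen_coinduced)

theorem isOpen_preimage_basicOpen {X : Finset V} (𝓒 : Set (G.ComponentCompl (X : Set V))) :
    IsOpen (TangleComp.point ⁻¹' basicOpen 𝓒 : Set (Complex G)) := by
  refine Complex.isOpen_iff.2 fun e => ?_
  have he : e.1 = s((Quot.out e.1).1, (Quot.out e.1).2) := (Quot.out_eq e.1).symm
  set a := (Quot.out e.1).1 with ha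
  set b := (Quot.out e.1).2 with hb
  -- On an edge with an endvertex in V[𝓒], at most the parameters 0 and 1 are missing, which leaves
  -- an open set.
  have hmem : ∀ t, edgeMap G e t ∈ (TangleComp.point ⁻¹' basicOpen 𝓒 : Set (Complex G)) ↔
      ((t ≠ 1 ∨ b ∈ verts 𝓒) ∧ (t ≠ 0 ∨ a ∈ verts 𝓒)) ∧ (a ∈ verts 𝓒 ∨ b ∈ verts 𝓒) := by
    intro t
    have h0 : (t : ℝ) = 0 ↔ t = 0 := Icc.coe_eq_zero
    have h1 : (t : ℝ) = 1 ↔ t = 1 := Icc.coe_eq_one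
    unfold edgeMap
    split_ifs with h h'
    · have ht0 : t ≠ 0 := fun h' => h.1.ne' (h0.2 h')
      have ht1 : t ≠ 1 := fun h' => h.2.ne (h1.2 h')
      change (∃ v ∈ e.1, v ∈ verts 𝓒) ↔ _
      rw [he]
      simp [ht0, ht1]
    · obtain rfl := h0.1 h'
      change a ∈ verts 𝓒 ↔ _
      simp +contextual
    · have ht : t = 1 := h1.1 (le_antisymm t.2.2
        (not_lt.1 fun hlt => h ⟨lt_of_le_of_ne t.2.1 (Ne.symm h'), hlt⟩))
      subst ht
      change b ∈ verts 𝓒 ↔ _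
      simp +contextual
  have : edgeMap G e ⁻¹' (TangleComp.point ⁻¹' basicOpen 𝓒) =
      {t | ((t ≠ 1 ∨ b ∈ verts 𝓒) ∧ (t ≠ 0 ∨ a ∈ verts 𝓒)) ∧ (a ∈ verts 𝓒 ∨ b ∈ verts 𝓒)} :=
    Set.ext hmem
  rw [this]
  exact ((isOpen_ne.union isOpen_const).and (isOpen_ne.union isOpen_const)).and isOpen_const

end ComplexTopology

section TangleTopology

theorem isOpen_image_point {U : Set (Complex G)} (hU : IsOpen U) :
    IsOpen (TangleComp.point '' U : Set (TangleComp G)) :=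
  TopologicalSpace.isOpen_generateFrom_of_mem (Or.inl ⟨U, hU, rfl⟩)

theorem TangleComp.point_injective :
    Function.Injective (TangleComp.point : Complex G → TangleComp G) :=
  fun _ _ h => TangleComp.point.inj h

theorem continuous_point : Continuous (TangleComp.point : Complex G → TangleComp G) := by
  refine continuous_generateFrom_iff.2 ?_
  rintro s (⟨U, hU, rfl⟩ | ⟨X, 𝓒, rfl⟩)
  · rwa [preimage_image_eq _ TangleComp.point_injective]
  · exact isOpen_preimage_basicOpen 𝓒

/-- Open sets of the 1-complex contain no tangles, so only the sets `basicOpen 𝓒` matter. -/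
theorem le_nhds_tangle {τ : Tangle G} {ℱ : Filter (TangleComp G)}
    (h : ∀ (X : Finset V), ∀ 𝓒 ∈ τ.ultra X, basicOpen 𝓒 ∈ ℱ) : ℱ ≤ 𝓝 (.tangle τ) := by
  rw [TopologicalSpace.nhds_generateFrom]
  refine le_iInf₂ fun s hs => le_principal_iff.2 ?_
  obtain ⟨hτ, ⟨U, -, rfl⟩ | ⟨X, 𝓒, rfl⟩⟩ := hs
  · obtain ⟨x, -, hx⟩ := hτ
    cases hx
  · exact h X 𝓒 hτ

/-- The filter on the vertex set generated by the strict big sides of a tangle. -/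
def Tangle.filter (τ : Tangle G) : Filter V where
  sets := {s | ∃ p ∈ τ.1, p.2 \ p.1 ⊆ s}
  univ_sets := ⟨_, τ.univ_mem_ultra ∅, subset_univ _⟩
  sets_of_superset := fun ⟨p, hp, h⟩ hs => ⟨p, hp, h.trans hs⟩
  inter_sets := fun ⟨_, hp, h⟩ ⟨_, hq, h'⟩ =>
    ⟨_, τ.sup_mem hp hq, fun _ hv => ⟨h ⟨hv.1.1, fun h => hv.2 (Or.inl h)⟩,
      h' ⟨hv.1.2, fun h => hv.2 (Or.inr h)⟩⟩⟩

instance (τ : Tangle G) : τ.filter.NeBot :=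
  forall_mem_nonempty_iff_neBot.1 fun _ ⟨_, hp, h⟩ => (τ.infinite_diff hp).nonempty.mono h

theorem tangle_mem_closure (τ : Tangle G) :
    TangleComp.tangle τ ∈ closure (range (TangleComp.point : Complex G → TangleComp G)) := by
  refine mem_closure_of_tendsto (b := τ.filter)
    (f := fun v => (TangleComp.point (.vertex v) : TangleComp G)) ?_
    (Eventually.of_forall fun v => mem_range_self _)
  exact le_nhds_tangle fun X 𝓒 h𝓒 => ⟨_, h𝓒, (sepTo_snd_diff 𝓒).subset⟩

end TangleTopology

/-! ### Compactness of |G|_Θ -/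

section Compactness

/-- The region of `|G|_Θ` towards which a separation points. -/
def sideRegion (G : SimpleGraph V) (p : Set V × Set V) : Set (TangleComp G) :=
  {x | match x with
    | .point (.vertex v) => v ∈ p.2 \ p.1
    | .point (.inner e _) => ∃ v ∈ e.1, v ∈ p.2 \ p.1
    | .tangle τ => p ∈ τ.1}

/-- The points of the induced subgraph `G[F]`, as a subset of `|G|_Θ`. -/
def inducedRegion (G : SimpleGraph V) (F : Set V) : Set (TangleComp G) :=
  {x | match x with
    | .point (.vertex v) => v ∈ F
    | .point (.inner e _) => ∀ v ∈ e.1, v ∈ F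
    | .tangle _ => False}

theorem basicOpen_eq_sideRegion {X : Finset V} (𝓒 : Set (G.ComponentCompl (X : Set V))) :
    basicOpen 𝓒 = sideRegion G (sepTo 𝓒) := by
  ext ((v | ⟨e, t⟩) | τ)
  · change v ∈ verts 𝓒 ↔ v ∈ (sepTo 𝓒).2 \ (sepTo 𝓒).1
    rw [sepTo_snd_diff]
  · change (∃ v ∈ e.1, v ∈ verts 𝓒) ↔ ∃ v ∈ e.1, v ∈ (sepTo 𝓒).2 \ (sepTo 𝓒).1
    rw [sepTo_snd_diff]
  · rfl

theorem adj_of_mem_edge (e : G.edgeSet) {u v : V} (hu : u ∈ e.1) (hv : v ∈ e.1) (h : u ≠ v) :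
    G.Adj u v := by
  have := (Sym2.mem_and_mem_iff h).1 ⟨hu, hv⟩
  rw [← mem_edgeSet, ← this]
  exact e.2

theorem exists_isCompact_inducedRegion_subset {F : Set V} (hF : F.Finite) :
    ∃ K : Set (TangleComp G), IsCompact K ∧ inducedRegion G F ⊆ K := by
  have hE : {e : G.edgeSet | ∀ v ∈ e.1, v ∈ F}.Finite := by
    lift F to Finset V using hF
    refine (F.sym2.finite_toSet.preimage Subtype.val_injective.injOn).subset fun e he => ?_
    exact Finset.mem_coe.2 (Finset.mem_sym2_iff.2 he)
  refine ⟨TangleComp.point '' (Complex.vertex '' F ∪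
    ⋃ e ∈ {e : G.edgeSet | ∀ v ∈ e.1, v ∈ F}, range (edgeMap G e)), ?_, ?_⟩
  · exact ((hF.image _).isCompact.union (hE.isCompact_biUnion fun e _ =>
      isCompact_range (continuous_edgeMap e))).image continuous_point
  · rintro ((v | ⟨e, t⟩) | τ) hx
    · exact mem_image_of_mem _ (Or.inl (mem_image_of_mem _ hx))
    · refine mem_image_of_mem _ (Or.inr (mem_biUnion (x := e) hx
        ⟨⟨t, Ioo_subset_Icc_self t.2⟩, ?_⟩))
      exact dif_pos t.2
    · exact hx.elim

/-- For `q = p.swap` this makes the orientation given by an ultrafilter unambiguous; for general `q`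
it makes it consistent. -/
theorem disjoint_sideRegion {p q : Set V × Set V} (hp : IsSeparation G p)
    (h : SepLE p.swap q) : Disjoint (sideRegion G p) (sideRegion G q) := by
  refine Set.disjoint_left.2 ?_
  rintro ((v | ⟨e, t⟩) | τ)
  · rintro (hv : v ∈ p.2 \ p.1) (hv' : v ∈ q.2 \ q.1)
    exact hv.2 (h.2 hv'.1)
  · rintro ⟨u, hu, hup⟩ ⟨w, hw, hwq⟩
    have hwp : w ∈ p.1 \ p.2 := ⟨h.2 hwq.1, fun h' => hwq.2 (h.1 h')⟩
    refine hp.2.2 w hwp u hup (adj_of_mem_edge e hw hu ?_)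
    rintro rfl
    exact hup.2 hwp.1
  · intro (hpτ : p ∈ τ.1) (hqτ : q ∈ τ.1)
    exact τ.swap_notMem hpτ (τ.mem_of_le hqτ hp.swap h)

theorem sideRegion_union {p : Set V × Set V} (hp : IsSeparation G p) :
    sideRegion G p ∪ sideRegion G p.swap ∪ inducedRegion G (p.1 ∩ p.2) = univ := by
  refine eq_univ_of_forall fun x => ?_
  by_contra hx
  simp only [mem_union, not_or] at hx
  obtain ⟨⟨h₁, h₂⟩, h₃⟩ := hx
  have key : ∀ v, v ∉ p.2 \ p.1 → v ∉ p.1 \ p.2 → v ∈ p.1 ∩ p.2 := fun v h h' => by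
    have := hp.mem_or v
    simp only [Set.mem_sdiff, mem_inter_iff] at *
    tauto
  rcases x with (v | ⟨e, t⟩) | τ
  · exact h₃ (key v h₁ h₂)
  · exact h₃ fun v hv => key v (fun h => h₁ ⟨v, hv, h⟩) fun h => h₂ ⟨v, hv, h⟩
  · exact (τ.mem_or_swap_mem hp).elim h₁ h₂

/-- An edge with one end strictly on the big side cannot have its other end outside that side, and
no tangle contains all of `σ`. -/
theorem biInter_sideRegion_subset {σ : Set (Set V × Set V)} (hσ : σ ∈ finiteStars G) :
    ⋂ p ∈ σ, sideRegion G p ⊆ inducedRegion G (starInterior σ) := by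
  intro x hx
  rw [mem_iInter₂] at hx
  rcases x with (v | ⟨e, t⟩) | τ
  · exact mem_iInter₂.2 fun p hp => (hx p hp).1
  · refine fun v hv => mem_iInter₂.2 fun p hp => ?_
    obtain ⟨u, hu, hup⟩ := hx p hp
    by_contra hvp
    have hsep := hσ.1 p hp
    refine hsep.2.2 v ⟨(hsep.mem_or v).resolve_right hvp, hvp⟩ u hup (adj_of_mem_edge e hv hu ?_)
    rintro rfl
    exact hvp hup.1
  · exact τ.2.2.2 σ (fun p hp => hx p hp) hσ

/-- An ultrafilter on `|G|_Θ` that contains no finite subgraph of `G` orients all separations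
as a tangle. -/
theorem isTangle_of_ultrafilter {𝒢 : Ultrafilter (TangleComp G)}
    (h : ∀ F : Set V, F.Finite → inducedRegion G F ∉ 𝒢) :
    IsTangle G (finiteStars G) {p | IsSeparation G p ∧ sideRegion G p ∈ 𝒢} := by
  have hdisj : ∀ p q, IsSeparation G p → SepLE p.swap q → sideRegion G p ∈ 𝒢 →
      sideRegion G q ∉ 𝒢 := fun p q hp hpq h₁ h₂ => by
    obtain ⟨x, hx, hx'⟩ := 𝒢.nonempty_of_mem (inter_mem h₁ h₂)
    exact Set.disjoint_left.1 (disjoint_sideRegion hp hpq) hx hx'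
  refine ⟨⟨fun p hp => hp.1, fun p hp => ?_⟩, ?_, fun σ hσ hstar => ?_⟩
  · have hu : sideRegion G p ∪ sideRegion G p.swap ∪ inducedRegion G (p.1 ∩ p.2) ∈ 𝒢 := by
      rw [sideRegion_union hp]
      exact univ_mem
    have hd := hdisj p p.swap hp ⟨Subset.rfl, Subset.rfl⟩
    rcases Ultrafilter.union_mem_iff.1 hu with h' | h'
    · rcases Ultrafilter.union_mem_iff.1 h' with h' | h'
      · exact Or.inl ⟨⟨hp, h'⟩, fun hs => hd h' hs.2⟩
      · exact Or.inr ⟨⟨hp.swap, h'⟩, fun hs => hd hs.2 h'⟩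
    · exact absurd h' (h _ hp.1)
  · rintro p hp q hq - ⟨hpq, -⟩
    exact hdisj p q hp.1 hpq hp.2 hq.2
  · refine h _ hstar.2.2.2 (mem_of_superset ?_ (biInter_sideRegion_subset hstar))
    exact (biInter_mem hstar.2.2.1).2 fun p hp => (hσ hp).2

instance : CompactSpace (TangleComp G) := by
  refine ⟨isCompact_iff_ultrafilter_le_nhds.2 fun 𝒢 _ => ?_⟩
  by_cases h : ∀ F : Set V, F.Finite → inducedRegion G F ∉ 𝒢
  · refine ⟨.tangle ⟨_, isTangle_of_ultrafilter h⟩, mem_univ _, le_nhds_tangle ?_⟩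
    intro X 𝓒 h𝓒
    rw [basicOpen_eq_sideRegion]
    exact h𝓒.2
  · push Not at h
    obtain ⟨F, hF, hF𝒢⟩ := h
    obtain ⟨K, hK, hFK⟩ := exists_isCompact_inducedRegion_subset (G := G) hF
    obtain ⟨x, -, hx⟩ := isCompact_iff_ultrafilter_le_nhds.1 hK 𝒢
      (le_principal_iff.2 (mem_of_superset hF𝒢 hFK))
    exact ⟨x, mem_univ x, hx⟩

end Compactness

/-! ### The quotient and its remainder -/

section CritCompactification

theorem CritComp.ofTangle_eq_iff {τ τ' : Tangle G} :
    CritComp.ofTangle τ = CritComp.ofTangle τ' ↔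
      τ = τ' ∨ ∃ X : Finset V, τ.IsX X ∧ τ'.IsX X := by
  refine Quotient.eq.trans ⟨?_, ?_⟩
  · rintro (h | ⟨σ, σ', h, h', X, hX⟩)
    · exact Or.inl (TangleComp.tangle.inj h)
    · cases h
      cases h'
      exact Or.inr ⟨X, hX⟩
  · rintro (rfl | ⟨X, hX⟩)
    · exact Or.inl rfl
    · exact Or.inr ⟨τ, τ', rfl, rfl, X, hX⟩

theorem mk_eq_ofPoint_iff {p : TangleComp G} {x : Complex G} :
    (Quotient.mk (tangleSetoid G) p : CritComp G) = CritComp.ofPoint x ↔ p = .point x := by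
  refine Quotient.eq.trans ⟨?_, ?_⟩
  · rintro (h | ⟨_, _, _, h, _⟩)
    · exact h
    · cases h
  · rintro rfl
    exact Or.inl rfl

/-- Points of G form singleton classes, so their open sets are saturated in |G|_Θ. -/
theorem isOpenEmbedding_ofPoint :
    IsOpenEmbedding (CritComp.ofPoint : Complex G → CritComp G) := by
  refine .of_continuous_injective_isOpenMap ?_ ?_ ?_
  · exact continuous_quotient_mk'.comp continuous_point
  · exact fun x y h => TangleComp.point_injective (mk_eq_ofPoint_iff.1 h)
  · intro U hU
    refine isOpen_coinduced.2 ?_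
    convert isOpen_image_point hU using 1
    ext p
    constructor
    · rintro ⟨x, hx, h⟩
      exact ⟨x, hx, (mk_eq_ofPoint_iff.1 h.symm).symm⟩
    · rintro ⟨x, hx, rfl⟩
      exact ⟨x, hx, rfl⟩

theorem denseRange_ofPoint : DenseRange (CritComp.ofPoint : Complex G → CritComp G) := by
  have : DenseRange (TangleComp.point : Complex G → TangleComp G) := by
    rintro (x | τ)
    · exact subset_closure (mem_range_self x)
    · exact tangle_mem_closure τ
  exact Quotient.mk_surjective.denseRange.comp this continuous_quotient_mk'

theorem isCompactification_ofPoint :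
    IsCompactification (CritComp.ofPoint : Complex G → CritComp G) :=
  ⟨inferInstance, isOpenEmbedding_ofPoint.isEmbedding, denseRange_ofPoint⟩

theorem CritComp.ofTangle_notMem_range (τ : Tangle G) :
    CritComp.ofTangle τ ∈ (range (CritComp.ofPoint : Complex G → CritComp G))ᶜ := by
  rintro ⟨x, hx⟩
  cases mk_eq_ofPoint_iff.1 hx.symm

/-- A tangle with `X_τ = X`. -/
noncomputable def Crit.tangle (X : Crit G) : Tangle G := X.2.exists_isX.choose

theorem Crit.isX_tangle (X : Crit G) : X.tangle.IsX X.1 := X.2.exists_isX.choose_spec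

theorem GEnd.not_isX (ω : GEnd G) (X : Finset V) : ¬ ω.tangle.IsX X :=
  fun h => ω.not_isUltrafilterTangle ⟨X, h.1⟩

theorem CritComp.ofTangle_eq_ofTangle_end_iff {τ : Tangle G} {ω : GEnd G} :
    CritComp.ofTangle τ = CritComp.ofTangle ω.tangle ↔ τ = ω.tangle :=
  ofTangle_eq_iff.trans (or_iff_left fun ⟨X, _, hX⟩ => ω.not_isX X hX)

/-- Shows that the class does not depend on the choice made in `Crit.tangle`. -/
theorem CritComp.ofTangle_eq_ofTangle_crit_iff {τ : Tangle G} {X : Crit G} :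
    CritComp.ofTangle τ = CritComp.ofTangle X.tangle ↔ τ.IsX X.1 := by
  refine ofTangle_eq_iff.trans ⟨?_, fun h => Or.inr ⟨X.1, h, X.isX_tangle⟩⟩
  rintro (rfl | ⟨Y, hτ, hY⟩)
  · exact X.isX_tangle
  · exact hY.unique X.isX_tangle ▸ hτ

/-- The point of the remainder of `|G|_Θ/∼` given by an end or a critical vertex set. -/
noncomputable def toRemainder (x : GEnd G ⊕ Crit G) :
    ((range (CritComp.ofPoint : Complex G → CritComp G))ᶜ : Set (CritComp G)) :=
  ⟨CritComp.ofTangle (x.elim GEnd.tangle Crit.tangle), CritComp.ofTangle_notMem_range _⟩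

theorem toRemainder_bijective : Function.Bijective (toRemainder (G := G)) := by
  constructor
  · rintro (ω | X) (ω' | X') h <;> have h := congrArg Subtype.val h
    · exact congrArg _ (GEnd.tangle_injective (CritComp.ofTangle_eq_ofTangle_end_iff.1 h))
    · exact (ω.not_isX _ (CritComp.ofTangle_eq_ofTangle_crit_iff.1 h)).elim
    · exact (ω'.not_isX _ (CritComp.ofTangle_eq_ofTangle_crit_iff.1 h.symm)).elim
    · exact congrArg _ (Subtype.ext
        (X.isX_tangle.unique (CritComp.ofTangle_eq_ofTangle_crit_iff.1 h)))
  · rintro ⟨x, hx⟩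
    induction x using Quotient.ind with
    | _ p =>
    rcases p with x | τ
    · exact absurd ⟨x, rfl⟩ hx
    by_cases hτ : τ.IsUltrafilterTangle
    · obtain ⟨X, hX⟩ := τ.exists_isX hτ
      let Y : Crit G := ⟨X, hX.isCritical⟩
      exact ⟨.inr Y, Subtype.ext (CritComp.ofTangle_eq_ofTangle_crit_iff (X := Y).2 hX).symm⟩
    · obtain ⟨ω, rfl⟩ := Tangle.exists_eq_tangle hτ
      exact ⟨.inl ω, rfl⟩

end CritCompactification

end GraphEnds

theorem theorem4p11 {V : Type u} [Infinite V] (G : SimpleGraph V) :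
    -- `X_τ` is defined for every ultrafilter tangle `τ`
    (∀ τ : GraphEnds.Tangle G, τ.IsUltrafilterTangle → ∃ X : Finset V, τ.IsX X) ∧
    -- `|G|_Θ/∼` is a compactification of the 1-complex of `G`
    GraphEnds.IsCompactification
      (GraphEnds.CritComp.ofPoint : GraphEnds.Complex G → GraphEnds.CritComp G) ∧
    -- its remainder consists of the ends and the critical vertex sets: an end `ω` is the class
    -- whose only element is `τ_ω`, and a critical `X` is the class of all `τ` with `X_τ = X`
    ∃ Φ : GraphEnds.GEnd G ⊕ GraphEnds.Crit G ≃
        ((range (GraphEnds.CritComp.ofPoint : GraphEnds.Complex G → GraphEnds.CritComp G))ᶜ :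
          Set (GraphEnds.CritComp G)),
      (∀ (ω : GraphEnds.GEnd G) (τ : GraphEnds.Tangle G),
        GraphEnds.CritComp.ofTangle τ = (Φ (Sum.inl ω) : GraphEnds.CritComp G) ↔
          τ.1 = ω.tangleSet) ∧
      (∀ (X : GraphEnds.Crit G) (τ : GraphEnds.Tangle G),
        GraphEnds.CritComp.ofTangle τ = (Φ (Sum.inr X) : GraphEnds.CritComp G) ↔
          τ.IsX X.1) := by
  refine ⟨fun τ hτ => τ.exists_isX hτ, GraphEnds.isCompactification_ofPoint,
    Equiv.ofBijective _ GraphEnds.toRemainder_bijective, fun ω τ => ?_, fun X τ => ?_⟩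
  · exact GraphEnds.CritComp.ofTangle_eq_ofTangle_end_iff.trans Subtype.ext_iff
  · exact GraphEnds.CritComp.ofTangle_eq_ofTangle_crit_iff
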